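/- Let $1\le d<K$ and let $\Phi\in\mathbb R^{K\times d}$ have rows $\phi_1,\dots,\phi_K$ (the arms' features) with $\|\phi_i\|_2\le 1$ for all $i$ and $\lambda_{\min}\big(\sum_{i=1}^d\phi_i\phi_i^\top\big)\ge 1$. For $\alpha$ in the simplex $\Delta_K$ with $\Phi^\top\mathrm{diag}(\alpha)\Phi$ invertible and $\mu\in\mathbb R^K$, let $\mathbf P^{\alpha}(\mu)=\arg\min_\theta\sum_i\alpha_i(\phi_i^\top\theta-\mu_i)^2$. The robust observation region $\mathcal C_k$ is the set of all $\mu\in\mathbb R^K$ with $\mu_k>\mu_i$ for all $i\ne k$ such that, for every such $\alpha$, $\phi_k^\top\mathbf P^\alpha(\mu)>\phi_i^\top\mathbf P^\alpha(\mu)$ for all $i\neq k$. Call $\Delta>0$ a model-space gap of $\mu\in\mathcal C_k$ if $\phi_k^\top\mathbf P^\alpha(\mu)-\phi_i^\top\mathbf P^\alpha(\mu)\ge\Delta$ for all such $\alpha$ and all $i\ne k$. LinUCB (OFUL) with parameters $R>0$, $\delta>0$ first plays each of the arms $1,\dots,d$ once. Then, in rounds $t=1,2,\dots$, it lets $V_t$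 be the sum of $\phi\phi^\top$ and $S_t$ the sum of $\phi\,y$ over all previous plays (forced ones included; $\phi$ the feature played, $y$ the observed reward), puts $\hat\theta_t=V_t^{-1}S_t$, and plays an arm $A_t$ such that $(A_t,\tilde\theta_t)$ maximizes $\phi_i^\top\theta$ over $i\in[K]$ and $\|\theta-\hat\theta_t\|_{V_t}\le\sqrt{\beta_t(\delta)}$, where $\beta_t(\delta)=2R^2\log\big((1+t/d)^{d/2}/\delta\big)$. Each play of an arm $i$ yields the reward $\mu_i$ plus noise, and the noise $\eta$ of every play (forced ones included) is conditionally $R$-sub-Gaussian: $\mathbf E[e^{\lambda\eta}\mid\text{arms up to and including this play, previous noises}]\le e^{\lambda^2R^2/2}$ for all $\lambda\in\mathbb R$. Let $\mu$ be an interior point of $\mathcal C_k$ (so that $k=\mathrm{OPT}(\mu)$), and let $\Delta_{\max}=\max_i(\mu_k-\mu_i)$. Then LinUCB has regret $\widetilde O(d\sqrt T)$ on $\mu$ with high probability. Explicitly: (a) There is a model-space gap $\Delta_{\min}>0$ of $\mu$, depending only on $\Phi$ and $\mu$, such that for all $R>0$ and $\delta>0$ and all noise as above, with probability at least $1-\delta$,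 for all $t\ge1$, $$\sum_{s=1}^t\mathbb 1\{A_s\ne k\}\le\frac{4\sqrt t\,R}{\Delta_{\min}}\sqrt{\log\frac{(1+t/d)^{d/2}}{\delta}}\sqrt{\log(1+t/d)^d},\qquad \sum_{s=1}^t(\mu_k-\mu_{A_s})\le\frac{4\sqrt t\,R\,\Delta_{\max}}{\Delta_{\min}}\sqrt{\log\frac{(1+t/d)^{d/2}}{\delta}}\sqrt{\log(1+t/d)^d}.$$ (b) For every model-space gap $\Delta>0$ of $\mu$ and all $R,\delta>0$ there is $T_0$, depending only on $\Phi,\mu,\Delta,R,\delta$, such that for all noise as above, with probability at least $1-\delta$, both inequalities of (a), with $\Delta$ in place of $\Delta_{\min}$, hold for all $t\ge T_0$. -/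

import Mathlib

open MeasureTheory Matrix

noncomputable section

namespace MisspecifiedBandit

variable {K d : ℕ}

/-! ### Bandit instances, model estimates and robust regions

`Φ : Matrix (Fin K) (Fin d) ℝ` is the feature matrix, its row `Φ i` is the feature of arm `i`,
and `μ : Fin K → ℝ` is the vector of true mean rewards. -/

/-- Reward vectors for which arm `k` is the unique optimal arm. -/
def greedyRegion (k : Fin K) : Set (Fin K → ℝ) :=
  {μ | ∀ i, i ≠ k → μ i < μ k}

/-- Parameters `θ` with `Φ θ` in the `k`-th greedy region. -/
def robustParameterRegion (Φ : Matrix (Fin K) (Fin d) ℝ) (k : Fin K) : Set (Fin d → ℝ) :=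
  {θ | Φ *ᵥ θ ∈ greedyRegion k}

/-- The sampling distributions `α` in the simplex for which `Φᵀ diag(α) Φ` is invertible. -/
def samplingDistributions (Φ : Matrix (Fin K) (Fin d) ℝ) : Set (Fin K → ℝ) :=
  {α | α ∈ stdSimplex ℝ (Fin K) ∧ IsUnit (Φᵀ * Matrix.diagonal α * Φ)}

/-- `θ` is a model estimate of `μ` under the weights `α`: it minimizes the weighted
least-squares error `∑ i, α i * ((Φ θ) i - μ i) ^ 2`.
(It is unique when `Φᵀ diag(α) Φ` is invertible.) -/
def IsModelEstimate (Φ : Matrix (Fin K) (Fin d) ℝ) (α μ : Fin K → ℝ) (θ : Fin d → ℝ) : Prop :=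
  ∀ θ' : Fin d → ℝ,
    ∑ i, α i * ((Φ *ᵥ θ) i - μ i) ^ 2 ≤ ∑ i, α i * ((Φ *ᵥ θ') i - μ i) ^ 2

/-- Instances with optimal arm `k` all of whose model estimates lie in the `k`-th robust
parameter region. -/
def robustObservationRegion (Φ : Matrix (Fin K) (Fin d) ℝ) (k : Fin K) : Set (Fin K → ℝ) :=
  {μ | μ ∈ greedyRegion k ∧
    ∀ α ∈ samplingDistributions Φ, ∀ θ, IsModelEstimate Φ α μ θ → θ ∈ robustParameterRegion Φ k}

/-- `Δ` is a lower bound, over all sampling distributions, for the sub-optimality gaps of the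
arms `i ≠ k` in the model space. -/
def IsModelGap (Φ : Matrix (Fin K) (Fin d) ℝ) (μ : Fin K → ℝ) (k : Fin K) (Δ : ℝ) : Prop :=
  ∀ α ∈ samplingDistributions Φ, ∀ θ, IsModelEstimate Φ α μ θ →
    ∀ i, i ≠ k → Δ ≤ Φ k ⬝ᵥ θ - Φ i ⬝ᵥ θ

/-- The worst sub-optimality gap `max_i (μ_k - μ_i)`. -/
def maxGap (μ : Fin K → ℝ) (k : Fin K) : ℝ := ⨆ i, (μ k - μ i)

/-! ### The OFUL / LinUCB algorithm

Plays are indexed by `n = 0, 1, 2, …`. The plays `n < d` form the forced exploration phase;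
play `n = d + s` is round `t = s + 1` of the OFUL phase. -/

/-- The design matrix of the first `n` plays. -/
def designMatrix (Φ : Matrix (Fin K) (Fin d) ℝ) (a : ℕ → Fin K) (n : ℕ) :
    Matrix (Fin d) (Fin d) ℝ :=
  ∑ m ∈ Finset.range n, vecMulVec (Φ (a m)) (Φ (a m))

/-- The sum of the features of the first `n` plays weighted by the observed rewards `y`. -/
def responseVector (Φ : Matrix (Fin K) (Fin d) ℝ) (a : ℕ → Fin K) (y : ℕ → ℝ) (n : ℕ) :
    Fin d → ℝ :=
  ∑ m ∈ Finset.range n, y m • Φ (a m)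

/-- The least-squares estimate after `n` plays. -/
def lsEstimate (Φ : Matrix (Fin K) (Fin d) ℝ) (a : ℕ → Fin K) (y : ℕ → ℝ) (n : ℕ) :
    Fin d → ℝ :=
  (designMatrix Φ a n)⁻¹ *ᵥ responseVector Φ a y n

/-- `log ((1 + t/d)^(d/2) / δ)`. -/
def logTerm (d : ℕ) (δ : ℝ) (t : ℕ) : ℝ :=
  Real.log ((1 + (t : ℝ) / d) ^ ((d : ℝ) / 2) / δ)

/-- The squared confidence radius `β_t(δ) = 2 R² log ((1 + t/d)^(d/2) / δ)`. -/
def confidenceRadiusSq (d : ℕ) (R δ : ℝ) (t : ℕ) : ℝ :=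
  2 * R ^ 2 * logTerm d δ t

/-- The confidence ellipsoid used in round `s + 1` of the OFUL phase. -/
def confidenceSet (Φ : Matrix (Fin K) (Fin d) ℝ) (R δ : ℝ) (a : ℕ → Fin K) (y : ℕ → ℝ) (s : ℕ) :
    Set (Fin d → ℝ) :=
  {θ | √((θ - lsEstimate Φ a y (d + s)) ⬝ᵥ
        (designMatrix Φ a (d + s) *ᵥ (θ - lsEstimate Φ a y (d + s))))
      ≤ √(confidenceRadiusSq d R δ (s + 1))}

/-- The sequence of plays `a`, with observed rewards `y`, is produced by OFUL: the first `d` arms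
are played once each, and then every play maximizes `φ_i · θ` jointly over arms `i` and parameters
`θ` in the current confidence set (ties are broken in any way). -/
def FollowsOFUL (hdK : d ≤ K) (Φ : Matrix (Fin K) (Fin d) ℝ) (R δ : ℝ)
    (a : ℕ → Fin K) (y : ℕ → ℝ) : Prop :=
  (∀ i : Fin d, a i = Fin.castLE hdK i) ∧
  ∀ s : ℕ, ∃ θ ∈ confidenceSet Φ R δ a y s,
    ∀ j, ∀ θ' ∈ confidenceSet Φ R δ a y s, Φ j ⬝ᵥ θ' ≤ Φ (a (d + s)) ⬝ᵥ θ

/-- The design matrix `∑_{i ≤ d} φ_i φ_iᵀ` at the end of the forced exploration phase. -/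
def forcedDesign (hdK : d ≤ K) (Φ : Matrix (Fin K) (Fin d) ℝ) : Matrix (Fin d) (Fin d) ℝ :=
  ∑ i : Fin d, vecMulVec (Φ (Fin.castLE hdK i)) (Φ (Fin.castLE hdK i))

/-! ### The stochastic model -/

/-- The σ-algebra generated by the arms of the plays `0, …, n` and the noises of the plays
`0, …, n - 1`. -/
abbrev history {Ω : Type*} (A : ℕ → Ω → Fin K) (η : ℕ → Ω → ℝ) (n : ℕ) : MeasurableSpace Ω :=
  (⨆ m ∈ Set.Iic n, MeasurableSpace.comap (A m) inferInstance) ⊔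
    (⨆ m ∈ Set.Iio n, MeasurableSpace.comap (η m) inferInstance)

/-- A random run of OFUL on the instance `μ`: the reward of play `n` is `μ_{A_n} + η_n` with
conditionally `R`-sub-Gaussian noise `η_n`, and the arms are chosen by the algorithm. -/
structure IsOFULRun (hdK : d ≤ K) (Φ : Matrix (Fin K) (Fin d) ℝ) (μ : Fin K → ℝ) (R δ : ℝ)
    {Ω : Type*} [MeasurableSpace Ω] (P : Measure Ω)
    (A : ℕ → Ω → Fin K) (η : ℕ → Ω → ℝ) : Prop where
  measurable_arm : ∀ n, Measurable (A n)
  measurable_noise : ∀ n, Measurable (η n)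
  integrable_exp : ∀ n, ∀ l : ℝ, Integrable (fun ω => Real.exp (l * η n ω)) P
  subGaussian : ∀ n, ∀ l : ℝ,
    P[fun ω => Real.exp (l * η n ω) | history A η n] ≤ᵐ[P]
      fun _ => Real.exp (l ^ 2 * R ^ 2 / 2)
  follows : ∀ ω, FollowsOFUL hdK Φ R δ (fun n => A n ω) (fun n => μ (A n ω) + η n ω)

/-! ### Regret -/

/-- The number of plays of arms other than `k` in the first `t` rounds of the OFUL phase. -/
def suboptimalPlays (d : ℕ) (k : Fin K) (a : ℕ → Fin K) (t : ℕ) : ℝ :=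
  ∑ s ∈ Finset.range t, if a (d + s) ≠ k then (1 : ℝ) else 0

/-- The cumulative regret of the first `t` rounds of the OFUL phase. -/
def regret (d : ℕ) (μ : Fin K → ℝ) (k : Fin K) (a : ℕ → Fin K) (t : ℕ) : ℝ :=
  ∑ s ∈ Finset.range t, (μ k - μ (a (d + s)))

/-- `(4 √t R / Δ) √(log ((1 + t/d)^(d/2) / δ)) √(log ((1 + t/d)^d))`. -/
def playBound (d : ℕ) (R δ Δ : ℝ) (t : ℕ) : ℝ :=
  4 * √(t : ℝ) * R / Δ * √(logTerm d δ t) * √(Real.log ((1 + (t : ℝ) / d) ^ d))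

/-- `(4 √t R Δ_max / Δ) √(log ((1 + t/d)^(d/2) / δ)) √(log ((1 + t/d)^d))`. -/
def regretBound (d : ℕ) (R δ Δmax Δ : ℝ) (t : ℕ) : ℝ :=
  4 * √(t : ℝ) * R * Δmax / Δ * √(logTerm d δ t) * √(Real.log ((1 + (t : ℝ) / d) ^ d))

end MisspecifiedBandit

end

/-!
Let `e` be the noise and `W n` the square of the self-normalized norm `‖∑_{m < n} e_m φ_m‖` in the
inverse design matrix. Rounding the play counts down to powers of two leaves polynomially many (in
`log n`) quadratic forms, each within a factor `2` of the design matrix, and for each of them a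
finite piece of an adapted lattice contains an almost optimal tilt of the exponential
supermartingale. A union bound with Ville's maximal inequality gives `W n ≤ 2 R² log (1/δ)` up to an
excess of order `log log n + log log (1/δ)`, uniformly in `n`, whereas the squared radius `β_t(δ)`
of OFUL has an excess of order `log t`: the true ellipsoids are contained in those of the algorithm
after a burn-in time polynomial in `log (1/δ)`.

Moving `μ` inside the observation region along the span of the features shifts all its model
estimates in a direction of our choice, so an interior point has a positive model-space gap `Δ`.
The estimate built from the mean rewards is a model estimate with sampling weights proportional to
the play counts; optimism therefore makes a suboptimal arm pay `Δ` out of its confidence width, and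
it is played `O(R² log (1/δ) / Δ²)` times, which is eventually of smaller order than the claimed
`√t log t`. At early times either the claimed bound exceeds `t` or the radius is violated by at
most `Δ / 2`, which only costs a constant factor, absorbed in the choice of the gap.
-/

namespace MisspecifiedBandit

open scoped ENNReal

section Ville

variable {Ω : Type*} {m0 : MeasurableSpace Ω} {P : Measure Ω} {ℱ : Filtration ℕ m0}
  {M : ℕ → Ω → ℝ≥0∞}

theorem setOf_exists_lt_succ_le_subset {α β : Type*} [LinearOrder β] (f : ℕ → α → β) (c : β)
    (n : ℕ) : {x | ∃ m < n + 1, c ≤ f m x} ⊆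
      {x | ∀ m < n, f m x < c} \ {x | f n x < c} ∪ {x | ∃ m < n, c ≤ f m x} := by
  rintro x ⟨m, hm, hx⟩
  by_cases hbefore : ∃ m < n, c ≤ f m x
  · exact Or.inr hbefore
  · obtain rfl : m = n := by
      by_contra hmn
      exact hbefore ⟨m, by omega, hx⟩
    exact Or.inl ⟨fun i hi => not_le.1 fun h => hbefore ⟨i, hi, h⟩, not_lt.2 hx⟩

theorem setLIntegral_forall_lt_add_mul_measure_exists_le (hM : ∀ n, Measurable[ℱ n] (M n))
    (hstep : ∀ n s, MeasurableSet[ℱ n] s → ∫⁻ ω in s, M (n + 1) ω ∂P ≤ ∫⁻ ω in s, M n ω ∂P)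
    (c : ℝ≥0∞) (n : ℕ) :
    ∫⁻ ω in {ω | ∀ m < n, M m ω < c}, M n ω ∂P + c * P {ω | ∃ m < n, c ≤ M m ω}
      ≤ ∫⁻ ω, M 0 ω ∂P := by
  induction n with
  | zero => simp
  | succ n ih =>
    set B : Set Ω := {ω | ∀ m < n, M m ω < c}
    set U : Set Ω := {ω | ∃ m < n, c ≤ M m ω}
    have hlt : MeasurableSet[ℱ n] {ω | M n ω < c} := hM n measurableSet_Iio
    have hB : MeasurableSet[ℱ n] B := by
      have : B = ⋂ m ∈ Set.Iio n, {ω | M m ω < c} := by ext; simp [B]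
      rw [this]
      exact .biInter (Set.to_countable _) fun m hm =>
        ℱ.mono (Set.mem_Iio.1 hm).le _ (hM m measurableSet_Iio)
    have hB_succ : {ω | ∀ m < n + 1, M m ω < c} = B ∩ {ω | M n ω < c} := by
      ext ω
      exact Nat.forall_lt_succ_right
    have hU_succ : {ω | ∃ m < n + 1, c ≤ M m ω} ⊆ B \ {ω | M n ω < c} ∪ U :=
      setOf_exists_lt_succ_le_subset M c n
    have hmarkov : c * P (B \ {ω | M n ω < c}) ≤ ∫⁻ ω in B \ {ω | M n ω < c}, M n ω ∂P := by
      rw [← setLIntegral_const]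
      exact setLIntegral_mono' (ℱ.le n _ (hB.diff hlt)) fun ω hω => not_lt.1 hω.2
    rw [hB_succ]
    calc ∫⁻ ω in B ∩ {ω | M n ω < c}, M (n + 1) ω ∂P + c * P {ω | ∃ m < n + 1, c ≤ M m ω}
        ≤ ∫⁻ ω in B ∩ {ω | M n ω < c}, M n ω ∂P + c * (P (B \ {ω | M n ω < c}) + P U) := by
          refine add_le_add (hstep n _ (hB.inter hlt)) ?_
          gcongr
          exact (measure_mono hU_succ).trans (measure_union_le _ _)
      _ ≤ ∫⁻ ω in B ∩ {ω | M n ω < c}, M n ω ∂P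
            + (∫⁻ ω in B \ {ω | M n ω < c}, M n ω ∂P + c * P U) := by
          rw [mul_add]; gcongr
      _ = ∫⁻ ω in B, M n ω ∂P + c * P U := by
          rw [← add_assoc, lintegral_inter_add_sdiff _ _ (ℱ.le n _ hlt)]
      _ ≤ ∫⁻ ω, M 0 ω ∂P := ih

theorem ville_maximal_ineq (hM : ∀ n, Measurable[ℱ n] (M n))
    (hstep : ∀ n s, MeasurableSet[ℱ n] s → ∫⁻ ω in s, M (n + 1) ω ∂P ≤ ∫⁻ ω in s, M n ω ∂P)
    (c : ℝ≥0∞) : c * P {ω | ∃ n, c ≤ M n ω} ≤ ∫⁻ ω, M 0 ω ∂P := by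
  have hunion : {ω | ∃ n, c ≤ M n ω} = ⋃ n, {ω | ∃ m < n, c ≤ M m ω} := by
    ext ω
    simp only [Set.mem_ofPred_eq, Set.mem_iUnion]
    exact ⟨fun ⟨n, h⟩ => ⟨n + 1, n, n.lt_succ_self, h⟩, fun ⟨_, m, _, h⟩ => ⟨m, h⟩⟩
  have hmono : Monotone fun n => {ω | ∃ m < n, c ≤ M m ω} :=
    fun _ _ hab _ ⟨m, hm, h⟩ => ⟨m, hm.trans_le hab, h⟩
  rw [hunion, hmono.measure_iUnion, ENNReal.mul_iSup]
  exact iSup_le fun n =>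
    le_add_self.trans (setLIntegral_forall_lt_add_mul_measure_exists_le hM hstep c n)

theorem lintegral_mul_ofReal_le_of_condExp_le [IsFiniteMeasure P] {m : MeasurableSpace Ω}
    (hm : m ≤ m0) {f : Ω → ℝ} (hf : Integrable f P) (hf0 : 0 ≤ f) {c : ℝ}
    (hc : P[f | m] ≤ᵐ[P] fun _ => c) {g : Ω → ℝ≥0∞} (hg : Measurable[m] g) :
    ∫⁻ ω, g ω * ENNReal.ofReal (f ω) ∂P ≤ ENNReal.ofReal c * ∫⁻ ω, g ω ∂P := by
  have hset : ∀ s, MeasurableSet[m] s →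
      ∫⁻ ω in s, ENNReal.ofReal (f ω) ∂P ≤ ENNReal.ofReal c * P s := by
    intro s hs
    rw [← ofReal_integral_eq_lintegral_ofReal hf.integrableOn (.of_forall hf0),
      ← setIntegral_condExp hm hf hs]
    calc ENNReal.ofReal (∫ ω in s, (P[f | m]) ω ∂P)
        ≤ ENNReal.ofReal (∫ _ in s, c ∂P) := ENNReal.ofReal_le_ofReal
          (integral_mono_ae integrable_condExp.integrableOn (integrable_const c)
            (ae_restrict_of_ae hc))
      _ = ENNReal.ofReal c * P s := by
          rw [setIntegral_const, smul_eq_mul, mul_comm, ENNReal.ofReal_mul' measureReal_nonneg,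
            ofReal_measureReal]
  have hle : (P.withDensity fun ω => ENNReal.ofReal (f ω)).trim hm
      ≤ (ENNReal.ofReal c • P).trim hm := by
    refine Measure.le_iff.2 fun s hs => ?_
    rw [trim_measurableSet_eq hm hs, trim_measurableSet_eq hm hs, withDensity_apply _ (hm s hs)]
    exact hset s hs
  have h := lintegral_mono' hle (le_refl g)
  rw [lintegral_trim hm hg, lintegral_trim hm hg, lintegral_smul_measure,
    lintegral_withDensity_eq_lintegral_mul₀ hf.aemeasurable.ennreal_ofReal
      (hg.mono hm le_rfl).aemeasurable] at h
  simpa only [Pi.mul_apply, mul_comm, smul_eq_mul] using h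

end Ville

section SubGaussianNoise

variable {Ω ι : Type*}

/-- The exponent `∑_{m < n} (l_{a_m} e_m - l_{a_m}² R² / 2)` of the exponential supermartingale in
which the noise `e` of arm `i` is tilted by `l i`. -/
noncomputable def tiltExponent (R : ℝ) (l : ι → ℝ) (a : ℕ → ι) (e : ℕ → ℝ) (n : ℕ) : ℝ :=
  ∑ m ∈ Finset.range n, (l (a m) * e m - l (a m) ^ 2 * R ^ 2 / 2)

theorem tiltExponent_succ (R : ℝ) (l : ι → ℝ) (a : ℕ → ι) (e : ℕ → ℝ) (n : ℕ) :
    tiltExponent R l a e (n + 1)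
      = tiltExponent R l a e n + (l (a n) * e n - l (a n) ^ 2 * R ^ 2 / 2) :=
  Finset.sum_range_succ _ _

variable {m0 : MeasurableSpace Ω} [MeasurableSpace ι]

/-- The noise `η n` of a play of the arm `A n` is conditionally `R`-sub-Gaussian given `ℱ n`, where
`ℱ n` is the information available once the arm `A n` is chosen and before `η n` is revealed. -/
structure HasSubGaussianNoise (ℱ : Filtration ℕ m0) (P : Measure Ω) (A : ℕ → Ω → ι)
    (η : ℕ → Ω → ℝ) (R : ℝ) : Prop where
  measurable_arm : ∀ n, Measurable[ℱ n] (A n)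
  measurable_noise : ∀ n, Measurable[ℱ (n + 1)] (η n)
  integrable_exp : ∀ n, ∀ l : ℝ, Integrable (fun ω => Real.exp (l * η n ω)) P
  condExp_exp_le : ∀ n, ∀ l : ℝ,
    P[fun ω => Real.exp (l * η n ω) | ℱ n] ≤ᵐ[P] fun _ => Real.exp (l ^ 2 * R ^ 2 / 2)

variable [Finite ι] [MeasurableSingletonClass ι] {ℱ : Filtration ℕ m0} {P : Measure Ω}
  {A : ℕ → Ω → ι} {η : ℕ → Ω → ℝ} {R : ℝ}

namespace HasSubGaussianNoise

theorem measurable_tiltExponent (h : HasSubGaussianNoise ℱ P A η R) (l : ι → ℝ) (n : ℕ) :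
    Measurable[ℱ n] fun ω => tiltExponent R l (A · ω) (η · ω) n := by
  refine Finset.measurable_sum _ fun m hm => ?_
  have hmn : m < n := Finset.mem_range.1 hm
  have hl : Measurable[ℱ n] fun ω => l (A m ω) :=
    (measurable_of_finite l).comp ((h.measurable_arm m).mono (ℱ.mono hmn.le) le_rfl)
  have hη : Measurable[ℱ n] (η m) := (h.measurable_noise m).mono (ℱ.mono hmn) le_rfl
  exact (hl.mul hη).sub (((hl.pow_const 2).mul_const _).div_const _)

theorem setLIntegral_exp_tiltExponent_succ_le_of_subset [IsFiniteMeasure P]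
    (h : HasSubGaussianNoise ℱ P A η R) (l : ι → ℝ) {n : ℕ} {s : Set Ω}
    (hs : MeasurableSet[ℱ n] s) {i : ι} (hsi : s ⊆ A n ⁻¹' {i}) :
    ∫⁻ ω in s, ENNReal.ofReal (Real.exp (tiltExponent R l (A · ω) (η · ω) (n + 1))) ∂P
      ≤ ∫⁻ ω in s, ENNReal.ofReal (Real.exp (tiltExponent R l (A · ω) (η · ω) n)) ∂P := by
  set M : ℕ → Ω → ℝ≥0∞ := fun n ω =>
    ENNReal.ofReal (Real.exp (tiltExponent R l (A · ω) (η · ω) n)) with hM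
  set r : ℝ := l i ^ 2 * R ^ 2 / 2
  have hstep : ∀ ω, s.indicator (M (n + 1)) ω = ENNReal.ofReal (Real.exp (-r)) *
      (s.indicator (M n) ω * ENNReal.ofReal (Real.exp (l i * η n ω))) := by
    intro ω
    by_cases hω : ω ∈ s
    · have hAi : A n ω = i := hsi hω
      simp only [Set.indicator_of_mem hω, hM]
      rw [← ENNReal.ofReal_mul (Real.exp_pos _).le, ← ENNReal.ofReal_mul (Real.exp_pos _).le,
        ← Real.exp_add, ← Real.exp_add, tiltExponent_succ, hAi]
      congr 2
      ring
    · simp only [Set.indicator_of_notMem hω, zero_mul, mul_zero]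
  have hcond := lintegral_mul_ofReal_le_of_condExp_le (ℱ.le n) (h.integrable_exp n (l i))
    (fun _ => (Real.exp_pos _).le) (h.condExp_exp_le n (l i))
    ((Real.measurable_exp.comp (h.measurable_tiltExponent l n)).ennreal_ofReal.indicator hs)
  rw [← lintegral_indicator (ℱ.le n _ hs), ← lintegral_indicator (ℱ.le n _ hs)]
  calc ∫⁻ ω, s.indicator (M (n + 1)) ω ∂P
      = ENNReal.ofReal (Real.exp (-r)) *
          ∫⁻ ω, s.indicator (M n) ω * ENNReal.ofReal (Real.exp (l i * η n ω)) ∂P := by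
        rw [lintegral_congr hstep, lintegral_const_mul' _ _ ENNReal.ofReal_ne_top]
    _ ≤ ENNReal.ofReal (Real.exp (-r)) *
          (ENNReal.ofReal (Real.exp r) * ∫⁻ ω, s.indicator (M n) ω ∂P) := by
        gcongr
        exact hcond
    _ = ∫⁻ ω, s.indicator (M n) ω ∂P := by
        rw [← mul_assoc, ← ENNReal.ofReal_mul (Real.exp_pos _).le, ← Real.exp_add,
          neg_add_cancel, Real.exp_zero, ENNReal.ofReal_one, one_mul]

theorem setLIntegral_exp_tiltExponent_succ_le [IsFiniteMeasure P]
    (h : HasSubGaussianNoise ℱ P A η R) (l : ι → ℝ) {n : ℕ} {s : Set Ω}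
    (hs : MeasurableSet[ℱ n] s) :
    ∫⁻ ω in s, ENNReal.ofReal (Real.exp (tiltExponent R l (A · ω) (η · ω) (n + 1))) ∂P
      ≤ ∫⁻ ω in s, ENNReal.ofReal (Real.exp (tiltExponent R l (A · ω) (η · ω) n)) ∂P := by
  have hfiber : ∀ i, MeasurableSet[ℱ n] (s ∩ A n ⁻¹' {i}) := fun i =>
    hs.inter (h.measurable_arm n (measurableSet_singleton i))
  have hunion : s = ⋃ i, s ∩ A n ⁻¹' {i} := by
    rw [← Set.inter_iUnion, ← Set.preimage_iUnion, Set.iUnion_of_singleton, Set.preimage_univ,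
      Set.inter_univ]
  have hdisj : Pairwise (Function.onFun Disjoint fun i => s ∩ A n ⁻¹' {i}) := fun i j hij =>
    (Set.disjoint_singleton.2 hij).preimage (A n) |>.mono Set.inter_subset_right
      Set.inter_subset_right
  rw [hunion, lintegral_iUnion (fun i => ℱ.le n _ (hfiber i)) hdisj,
    lintegral_iUnion (fun i => ℱ.le n _ (hfiber i)) hdisj]
  exact ENNReal.tsum_le_tsum fun i =>
    h.setLIntegral_exp_tiltExponent_succ_le_of_subset l (hfiber i) Set.inter_subset_right

theorem measure_exists_le_tiltExponent_le [IsProbabilityMeasure P]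
    (h : HasSubGaussianNoise ℱ P A η R) (l : ι → ℝ) (x : ℝ) :
    P {ω | ∃ n, x ≤ tiltExponent R l (A · ω) (η · ω) n} ≤ ENNReal.ofReal (Real.exp (-x)) := by
  have hville := ville_maximal_ineq (P := P)
    (fun n => (Real.measurable_exp.comp (h.measurable_tiltExponent l n)).ennreal_ofReal)
    (fun n s hs => h.setLIntegral_exp_tiltExponent_succ_le l hs) (ENNReal.ofReal (Real.exp x))
  simp only [Function.comp_apply, ENNReal.ofReal_le_ofReal_iff (Real.exp_pos _).le,
    Real.exp_le_exp, tiltExponent, Finset.range_zero, Finset.sum_empty, Real.exp_zero,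
    ENNReal.ofReal_one, lintegral_one, measure_univ] at hville
  rw [Real.exp_neg, ENNReal.ofReal_inv_of_pos (Real.exp_pos x), ENNReal.le_inv_iff_mul_le, mul_comm]
  exact hville

end HasSubGaussianNoise

variable {K d : ℕ} {A : ℕ → Ω → Fin K}

/-- The filtration of the σ-algebras `history A η n`. -/
def historyFiltration (hA : ∀ n, Measurable (A n)) (hη : ∀ n, Measurable (η n)) :
    Filtration ℕ m0 where
  seq := history A η
  mono' _ _ hab := sup_le_sup (biSup_mono fun _ hm => le_trans hm hab)
    (biSup_mono fun _ hm => lt_of_lt_of_le hm hab)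
  le' _ := sup_le (iSup₂_le fun m _ => (hA m).comap_le) (iSup₂_le fun m _ => (hη m).comap_le)

theorem IsOFULRun.hasSubGaussianNoise {hdK : d ≤ K} {Φ : Matrix (Fin K) (Fin d) ℝ}
    {μ : Fin K → ℝ} {δ : ℝ} (h : IsOFULRun hdK Φ μ R δ P A η) :
    HasSubGaussianNoise (historyFiltration h.measurable_arm h.measurable_noise) P A η R where
  measurable_arm _ := measurable_iff_comap_le.2 <| le_sup_of_le_left <|
    le_biSup (fun m => MeasurableSpace.comap (A m) inferInstance) (Set.mem_Iic.2 le_rfl)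
  measurable_noise n := measurable_iff_comap_le.2 <| le_sup_of_le_right <|
    le_biSup (fun m => MeasurableSpace.comap (η m) inferInstance) (Set.mem_Iio.2 n.lt_succ_self)
  integrable_exp := h.integrable_exp
  condExp_exp_le := h.subGaussian

end SubGaussianNoise

section WeightedNorm

variable {ι : Type*} [Fintype ι] {V : Matrix ι ι ℝ}

/-- The norm `‖v‖_V = √(vᵀ V v)` attached to a positive semidefinite matrix `V`, such as the norms
in which the confidence ellipsoids are balls. -/
noncomputable def weightedNorm (V : Matrix ι ι ℝ) (v : ι → ℝ) : ℝ :=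
  √(v ⬝ᵥ (V *ᵥ v))

theorem weightedNorm_nonneg (V : Matrix ι ι ℝ) (v : ι → ℝ) : 0 ≤ weightedNorm V v :=
  Real.sqrt_nonneg _

theorem weightedNorm_smul (V : Matrix ι ι ℝ) (c : ℝ) (v : ι → ℝ) :
    weightedNorm V (c • v) = |c| * weightedNorm V v := by
  rw [weightedNorm, weightedNorm, mulVec_smul, smul_dotProduct, dotProduct_smul, smul_eq_mul,
    smul_eq_mul, ← mul_assoc, ← pow_two, Real.sqrt_mul (sq_nonneg c), Real.sqrt_sq_eq_abs]

theorem dotProduct_mulVec_self_nonneg (hV : V.PosSemidef) (v : ι → ℝ) : 0 ≤ v ⬝ᵥ (V *ᵥ v) := by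
  simpa only [star_trivial] using hV.dotProduct_mulVec_nonneg v

theorem sq_weightedNorm (hV : V.PosSemidef) (v : ι → ℝ) :
    weightedNorm V v ^ 2 = v ⬝ᵥ (V *ᵥ v) :=
  Real.sq_sqrt (dotProduct_mulVec_self_nonneg hV v)

theorem dotProduct_mulVec_comm (hV : V.PosSemidef) (u v : ι → ℝ) :
    u ⬝ᵥ (V *ᵥ v) = v ⬝ᵥ (V *ᵥ u) := by
  have hT : Vᵀ = V := by simpa [conjTranspose_eq_transpose_of_trivial] using hV.isHermitian.eq
  rw [dotProduct_comm u, ← vecMul_transpose, hT, dotProduct_mulVec]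

theorem sq_weightedNorm_add (hV : V.PosSemidef) (u v : ι → ℝ) :
    weightedNorm V (u + v) ^ 2
      = weightedNorm V u ^ 2 + 2 * (u ⬝ᵥ (V *ᵥ v)) + weightedNorm V v ^ 2 := by
  rw [sq_weightedNorm hV, sq_weightedNorm hV, sq_weightedNorm hV, mulVec_add, add_dotProduct,
    dotProduct_add, dotProduct_add, dotProduct_mulVec_comm hV v u]
  ring

theorem abs_dotProduct_mulVec_le (hV : V.PosSemidef) (u v : ι → ℝ) :
    |u ⬝ᵥ (V *ᵥ v)| ≤ weightedNorm V u * weightedNorm V v := by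
  classical
  refine abs_le_of_sq_le_sq ?_ (mul_nonneg (weightedNorm_nonneg V u) (weightedNorm_nonneg V v))
  rw [mul_pow, sq_weightedNorm hV, sq_weightedNorm hV]
  have hcs := LinearMap.BilinForm.apply_sq_le_of_symm (toLinearMap₂' ℝ V)
    (fun x => by
      simpa only [toLinearMap₂'_apply'] using dotProduct_mulVec_self_nonneg hV x)
    ⟨fun x y => by
      simpa only [toLinearMap₂'_apply', RingHom.id_apply] using dotProduct_mulVec_comm hV x y⟩ u v
  simpa only [toLinearMap₂'_apply'] using hcs

theorem weightedNorm_add_le (hV : V.PosSemidef) (u v : ι → ℝ) :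
    weightedNorm V (u + v) ≤ weightedNorm V u + weightedNorm V v := by
  refine (sq_le_sq₀ (weightedNorm_nonneg V _)
    (add_nonneg (weightedNorm_nonneg V u) (weightedNorm_nonneg V v))).1 ?_
  rw [sq_weightedNorm_add hV, add_sq, mul_assoc 2 (weightedNorm V u)]
  gcongr
  exact (le_abs_self _).trans (abs_dotProduct_mulVec_le hV u v)

theorem exists_int_dotProduct_sub_self_le (y : ι → ℝ) {M : ℕ} (hy : y ⬝ᵥ y ≤ (M : ℝ) ^ 2) :
    ∃ p : ι → ℤ, (∀ i, |p i| ≤ M) ∧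
      ((fun i => (p i : ℝ)) - y) ⬝ᵥ ((fun i => (p i : ℝ)) - y) ≤ Fintype.card ι / 4 := by
  refine ⟨fun i => round (y i), fun i => ?_, ?_⟩
  · have hyi : |y i| ≤ M := by
      refine abs_le_of_sq_le_sq (le_trans ?_ hy) M.cast_nonneg
      rw [pow_two]
      exact Finset.single_le_sum (f := fun i => y i * y i) (fun j _ => mul_self_nonneg _)
        (Finset.mem_univ i)
    have hround := abs_sub_round (y i)
    have hlt : |(round (y i) : ℝ)| < M + 1 := by
      rw [abs_le] at hyi hround
      rw [abs_lt]
      constructor <;> linarith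
    exact Int.lt_add_one_iff.1 (by exact_mod_cast hlt)
  · calc ∑ i, (round (y i) - y i) * (round (y i) - y i)
        ≤ ∑ _i : ι, (1 / 4 : ℝ) := by
          refine Finset.sum_le_sum fun i _ => ?_
          have hround := abs_le.1 (abs_sub_round (y i))
          nlinarith
      _ = Fintype.card ι / 4 := by
          rw [Finset.sum_const, Finset.card_univ, nsmul_eq_mul, mul_one_div]

variable [DecidableEq ι]

theorem mulVec_inv_mulVec {B : Matrix ι ι ℝ} (hB : IsUnit B) (x : ι → ℝ) :
    B *ᵥ (B⁻¹ *ᵥ x) = x := by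
  rw [mulVec_mulVec, mul_nonsing_inv _ ((isUnit_iff_isUnit_det _).1 hB), one_mulVec]

theorem weightedNorm_inv_mulVec (hV : IsUnit V) (x : ι → ℝ) :
    weightedNorm V (V⁻¹ *ᵥ x) = weightedNorm V⁻¹ x := by
  rw [weightedNorm, weightedNorm, mulVec_inv_mulVec hV, dotProduct_comm]

theorem abs_dotProduct_le (hV : V.PosDef) (x v : ι → ℝ) :
    |x ⬝ᵥ v| ≤ weightedNorm V⁻¹ x * weightedNorm V v := by
  have h := abs_dotProduct_mulVec_le hV.posSemidef v (V⁻¹ *ᵥ x)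
  rwa [mulVec_inv_mulVec hV.isUnit, weightedNorm_inv_mulVec hV.isUnit, dotProduct_comm,
    mul_comm] at h

theorem mul_sq_weightedNorm_inv_le_one (hV : V.PosDef) {c : ℝ} {x : ι → ℝ}
    (h : ∀ v, c * (x ⬝ᵥ v) ^ 2 ≤ weightedNorm V v ^ 2) : c * weightedNorm V⁻¹ x ^ 2 ≤ 1 := by
  have hx := h (V⁻¹ *ᵥ x)
  rw [weightedNorm_inv_mulVec hV.isUnit, ← sq_weightedNorm hV.inv.posSemidef] at hx
  rcases (sq_nonneg (weightedNorm V⁻¹ x)).eq_or_lt with h0 | h0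
  · rw [← h0, mul_zero]
    exact zero_le_one
  · exact le_of_mul_le_mul_right (by linarith) h0

theorem dotProduct_sub_half_sq_weightedNorm (hV : V.PosDef) (l z : ι → ℝ) :
    l ⬝ᵥ z - weightedNorm V l ^ 2 / 2
      = weightedNorm V⁻¹ z ^ 2 / 2 - weightedNorm V (l - V⁻¹ *ᵥ z) ^ 2 / 2 := by
  have h := sq_weightedNorm_add hV.posSemidef (l - V⁻¹ *ᵥ z) (V⁻¹ *ᵥ z)
  rw [sub_add_cancel, mulVec_inv_mulVec hV.isUnit, sub_dotProduct,
    weightedNorm_inv_mulVec hV.isUnit, dotProduct_comm (V⁻¹ *ᵥ z),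
    ← sq_weightedNorm hV.inv.posSemidef] at h
  linarith

theorem weightedNorm_inv_le_of_net (hV : V.PosDef) {b g : ℝ} (hg : 0 ≤ g) (hgb : g ≤ b)
    {N : Set (ι → ℝ)} (hnet : ∀ v, weightedNorm V v ≤ b → ∃ l ∈ N, weightedNorm V (l - v) ≤ g)
    {z : ι → ℝ} (hz : ∀ l ∈ N, l ⬝ᵥ z - weightedNorm V l ^ 2 / 2 < (b ^ 2 - g ^ 2) / 2) :
    weightedNorm V⁻¹ z ≤ b := by
  by_contra! hbS
  set S := weightedNorm V⁻¹ z
  set ν := V⁻¹ *ᵥ z with hν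
  have hb : 0 ≤ b := hg.trans hgb
  have hS : 0 < S := hb.trans_lt hbS
  have hνS : weightedNorm V ν = S := weightedNorm_inv_mulVec hV.isUnit z
  obtain ⟨l, hlN, hl⟩ := hnet ((b / S) • ν) <| by
    rw [weightedNorm_smul, hνS, abs_of_nonneg (div_nonneg hb hS.le), div_mul_cancel₀ _ hS.ne']
  have hlν : weightedNorm V (l - ν) ≤ g + (S - b) :=
    calc weightedNorm V (l - ν)
        = weightedNorm V ((l - (b / S) • ν) + (b / S - 1) • ν) := by
          rw [sub_smul, one_smul, sub_add_sub_cancel]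
      _ ≤ g + |b / S - 1| * S := by
          refine (weightedNorm_add_le hV.posSemidef _ _).trans (add_le_add hl ?_)
          rw [weightedNorm_smul, hνS]
      _ = g + (S - b) := by
          rw [abs_of_neg (by rw [sub_neg, div_lt_one hS]; exact hbS)]
          field_simp
          ring
  have hsq : weightedNorm V (l - ν) ^ 2 ≤ (g + (S - b)) ^ 2 :=
    pow_le_pow_left₀ (weightedNorm_nonneg V _) hlν 2
  have hlz := hz l hlN
  rw [dotProduct_sub_half_sq_weightedNorm hV, ← hν] at hlz
  nlinarith [mul_nonneg (sub_nonneg.2 hgb) (sub_nonneg.2 hbS.le)]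

theorem exists_int_sq_weightedNorm_inv_mulVec_sub_le {B : Matrix ι ι ℝ} (hB : IsUnit B)
    (hVB : ∀ v, weightedNorm V v ^ 2 ≤ 2 * ((B *ᵥ v) ⬝ᵥ (B *ᵥ v))) {M : ℕ}
    {v : ι → ℝ} (hv : (B *ᵥ v) ⬝ᵥ (B *ᵥ v) ≤ (M : ℝ) ^ 2) :
    ∃ p : ι → ℤ, (∀ i, |p i| ≤ M) ∧
      weightedNorm V (B⁻¹ *ᵥ (fun i => (p i : ℝ)) - v) ^ 2 ≤ Fintype.card ι / 2 := by
  obtain ⟨p, hpM, hp⟩ := exists_int_dotProduct_sub_self_le (B *ᵥ v) hv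
  refine ⟨p, hpM, (hVB _).trans ?_⟩
  rw [mulVec_sub, mulVec_inv_mulVec hB]
  linarith

end WeightedNorm

section Optimism

variable {ι : Type*} [Fintype ι] [DecidableEq ι] {V : Matrix ι ι ℝ} {θ₀ θhat : ι → ℝ} {r ρ : ℝ}

theorem exists_weightedNorm_le_dotProduct_eq (hV : V.PosDef) (hr : 0 ≤ r) (y : ι → ℝ) :
    ∃ v, weightedNorm V v ≤ r ∧ y ⬝ᵥ v = r * weightedNorm V⁻¹ y := by
  set Y := weightedNorm V⁻¹ y
  refine ⟨(r / Y) • (V⁻¹ *ᵥ y), ?_, ?_⟩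
  · rw [weightedNorm_smul, weightedNorm_inv_mulVec hV.isUnit,
      abs_of_nonneg (div_nonneg hr (weightedNorm_nonneg _ _)), div_mul_comm]
    exact mul_le_of_le_one_left hr (div_self_le_one Y)
  · rw [dotProduct_smul, ← sq_weightedNorm hV.inv.posSemidef, smul_eq_mul, pow_two,
      div_mul_eq_mul_div, mul_div_assoc, mul_self_div_self]

/-- Replacing `θ₀` by the estimate costs `ρ ‖φ‖` for each feature `φ`; the optimistic value of `y`
exceeds its estimated value by `r ‖y‖`, and that of `x` by at most `r ‖x‖`. -/
theorem dotProduct_sub_le_of_optimistic (hV : V.PosDef) (hr : 0 ≤ r) {x y θ : ι → ℝ}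
    (hθ₀ : weightedNorm V (θhat - θ₀) ≤ ρ) (hθ : weightedNorm V (θ - θhat) ≤ r)
    (hmax : ∀ θ', weightedNorm V (θ' - θhat) ≤ r → y ⬝ᵥ θ' ≤ x ⬝ᵥ θ) :
    y ⬝ᵥ θ₀ - x ⬝ᵥ θ₀ ≤ (ρ + r) * weightedNorm V⁻¹ x + (ρ - r) * weightedNorm V⁻¹ y := by
  obtain ⟨v, hv, hyv⟩ := exists_weightedNorm_le_dotProduct_eq hV hr y
  have hopt : y ⬝ᵥ (θhat + v) ≤ x ⬝ᵥ θ := hmax _ (by rwa [add_sub_cancel_left])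
  have hx : x ⬝ᵥ (θ - θhat) ≤ weightedNorm V⁻¹ x * r := ((le_abs_self _).trans
    (abs_dotProduct_le hV x _)).trans (mul_le_mul_of_nonneg_left hθ (weightedNorm_nonneg _ _))
  have hρ : ∀ u, |u ⬝ᵥ (θhat - θ₀)| ≤ weightedNorm V⁻¹ u * ρ := fun u =>
    (abs_dotProduct_le hV u _).trans (mul_le_mul_of_nonneg_left hθ₀ (weightedNorm_nonneg _ _))
  have hxρ := (abs_le.1 (hρ x)).2
  have hyρ := (abs_le.1 (hρ y)).1
  rw [dotProduct_add, hyv] at hopt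
  rw [dotProduct_sub] at hx hxρ hyρ
  linarith

end Optimism

section Gram

variable {κ ι : Type*} [Fintype κ] [DecidableEq κ]

/-- The Gram matrix of the rows of `Φ` with weights `w`. Both the matrices of sampling
distributions and the design matrices are of this form. -/
def weightedGram (Φ : Matrix κ ι ℝ) (w : κ → ℝ) : Matrix ι ι ℝ :=
  Φᵀ * Matrix.diagonal w * Φ

theorem weightedGram_smul (Φ : Matrix κ ι ℝ) (c : ℝ) (w : κ → ℝ) :
    weightedGram Φ (c • w) = c • weightedGram Φ w := by
  rw [weightedGram, weightedGram, diagonal_smul, Matrix.mul_smul, Matrix.smul_mul]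

theorem weightedGram_posSemidef [Finite ι] (Φ : Matrix κ ι ℝ) {w : κ → ℝ} (hw : 0 ≤ w) :
    (weightedGram Φ w).PosSemidef := by
  rw [weightedGram, ← conjTranspose_eq_transpose_of_trivial]
  exact (PosSemidef.diagonal hw).conjTranspose_mul_mul_same Φ

variable [Fintype ι]

theorem dotProduct_weightedGram_mulVec (Φ : Matrix κ ι ℝ) (w : κ → ℝ) (u v : ι → ℝ) :
    u ⬝ᵥ (weightedGram Φ w *ᵥ v) = ∑ i, w i * ((Φ i ⬝ᵥ u) * (Φ i ⬝ᵥ v)) := by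
  rw [weightedGram, Matrix.mul_assoc, ← mulVec_mulVec, dotProduct_mulVec, vecMul_transpose,
    ← mulVec_mulVec, dotProduct]
  refine Finset.sum_congr rfl fun i _ => ?_
  rw [mulVec_diagonal, mulVec, mulVec]
  ring

theorem dotProduct_weightedGram_mulVec_self (Φ : Matrix κ ι ℝ) (w : κ → ℝ) (v : ι → ℝ) :
    v ⬝ᵥ (weightedGram Φ w *ᵥ v) = ∑ i, w i * (Φ i ⬝ᵥ v) ^ 2 := by
  simp only [dotProduct_weightedGram_mulVec, pow_two]

theorem sq_weightedNorm_weightedGram (Φ : Matrix κ ι ℝ) {w : κ → ℝ} (hw : 0 ≤ w) (v : ι → ℝ) :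
    weightedNorm (weightedGram Φ w) v ^ 2 = ∑ i, w i * (Φ i ⬝ᵥ v) ^ 2 := by
  rw [sq_weightedNorm (weightedGram_posSemidef Φ hw), dotProduct_weightedGram_mulVec_self]

theorem sq_dotProduct_le_of_norm_le_one {x : ι → ℝ} (hx : ‖WithLp.toLp 2 x‖ ≤ 1) (v : ι → ℝ) :
    (x ⬝ᵥ v) ^ 2 ≤ v ⬝ᵥ v := by
  have hxx : x ⬝ᵥ x ≤ 1 := by
    have hx2 := pow_le_one₀ (n := 2) (norm_nonneg _) hx
    rw [EuclideanSpace.real_norm_sq_eq] at hx2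
    simpa only [dotProduct, pow_two] using hx2
  calc (x ⬝ᵥ v) ^ 2 ≤ (x ⬝ᵥ x) * (v ⬝ᵥ v) := by
        simpa only [dotProduct, pow_two] using
          Finset.sum_mul_sq_le_sq_mul_sq Finset.univ x v
    _ ≤ v ⬝ᵥ v := mul_le_of_le_one_left (dotProduct_star_self_nonneg v) hxx

end Gram

section PlayCount

/-- The number of plays of arm `i` among the first `n` plays. -/
abbrev playCount {κ : Type*} [DecidableEq κ] (a : ℕ → κ) (n : ℕ) (i : κ) : ℕ :=
  Nat.count (a · = i) n

theorem sum_range_comp_eq_sum_playCount_smul {κ M : Type*} [DecidableEq κ] [Fintype κ]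
    [AddCommMonoid M] (a : ℕ → κ) (n : ℕ) (f : κ → M) :
    ∑ m ∈ Finset.range n, f (a m) = ∑ i, playCount a n i • f i := by
  rw [← Finset.sum_fiberwise (Finset.range n) a]
  refine Finset.sum_congr rfl fun i _ => ?_
  rw [playCount, Nat.count_eq_card_filter_range, ← Finset.sum_const]
  exact Finset.sum_congr rfl fun m hm => by rw [(Finset.mem_filter.1 hm).2]

variable {K d : ℕ}

theorem designMatrix_eq_weightedGram (Φ : Matrix (Fin K) (Fin d) ℝ) (a : ℕ → Fin K) (n : ℕ) :
    designMatrix Φ a n = weightedGram Φ fun i => (playCount a n i : ℝ) := by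
  rw [designMatrix, sum_range_comp_eq_sum_playCount_smul a n fun i => vecMulVec (Φ i) (Φ i),
    weightedGram]
  ext p q
  rw [Matrix.sum_apply, mul_apply]
  refine Finset.sum_congr rfl fun i _ => ?_
  rw [Matrix.smul_apply, vecMulVec_apply, mul_diagonal, transpose_apply, nsmul_eq_mul]
  ring

theorem sq_weightedNorm_designMatrix (Φ : Matrix (Fin K) (Fin d) ℝ) (a : ℕ → Fin K) (n : ℕ)
    (v : Fin d → ℝ) :
    weightedNorm (designMatrix Φ a n) v ^ 2 = ∑ i, (playCount a n i : ℝ) * (Φ i ⬝ᵥ v) ^ 2 := by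
  rw [designMatrix_eq_weightedGram, sq_weightedNorm_weightedGram Φ fun i => Nat.cast_nonneg _]

theorem one_le_playCount_castLE {hdK : d ≤ K} {a : ℕ → Fin K}
    (ha : ∀ i : Fin d, a i = Fin.castLE hdK i) {n : ℕ} (hn : d ≤ n) (i : Fin d) :
    1 ≤ playCount a n (Fin.castLE hdK i) := by
  rw [playCount, Nat.count_eq_card_filter_range]
  exact Finset.card_pos.2 ⟨i, Finset.mem_filter.2 ⟨Finset.mem_range.2 (i.2.trans_le hn), ha i⟩⟩

end PlayCount

section ForcedDesign

variable {K d : ℕ} {hdK : d ≤ K} {Φ : Matrix (Fin K) (Fin d) ℝ}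

theorem dotProduct_self_le_sum_castLE (hforced : (forcedDesign hdK Φ - 1).PosSemidef)
    (v : Fin d → ℝ) : v ⬝ᵥ v ≤ ∑ j : Fin d, (Φ (Fin.castLE hdK j) ⬝ᵥ v) ^ 2 := by
  have h := hforced.dotProduct_mulVec_nonneg v
  simp only [star_trivial, sub_mulVec, dotProduct_sub, one_mulVec, forcedDesign, sum_mulVec,
    dotProduct_sum, vecMulVec_mulVec, op_smul_eq_smul, dotProduct_smul, smul_eq_mul] at h
  simpa only [pow_two, dotProduct_comm v (Φ _)] using sub_nonneg.1 h

theorem dotProduct_self_le_dotProduct_weightedGram_mulVec_self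
    (hforced : (forcedDesign hdK Φ - 1).PosSemidef) {w : Fin K → ℝ} (hw : 0 ≤ w)
    (hw1 : ∀ i : Fin d, 1 ≤ w (Fin.castLE hdK i)) (v : Fin d → ℝ) :
    v ⬝ᵥ v ≤ v ⬝ᵥ (weightedGram Φ w *ᵥ v) := by
  calc v ⬝ᵥ v ≤ ∑ j : Fin d, (Φ (Fin.castLE hdK j) ⬝ᵥ v) ^ 2 :=
        dotProduct_self_le_sum_castLE hforced v
    _ ≤ ∑ j : Fin d, w (Fin.castLE hdK j) * (Φ (Fin.castLE hdK j) ⬝ᵥ v) ^ 2 :=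
        Finset.sum_le_sum fun j _ => le_mul_of_one_le_left (sq_nonneg _) (hw1 j)
    _ = ∑ i ∈ Finset.univ.map (Fin.castLEEmb hdK), w i * (Φ i ⬝ᵥ v) ^ 2 := by
        rw [Finset.sum_map]; rfl
    _ ≤ ∑ i, w i * (Φ i ⬝ᵥ v) ^ 2 :=
        Finset.sum_le_sum_of_subset_of_nonneg (Finset.subset_univ _)
          fun i _ _ => mul_nonneg (hw i) (sq_nonneg _)
    _ = v ⬝ᵥ (weightedGram Φ w *ᵥ v) := (dotProduct_weightedGram_mulVec_self Φ w v).symm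

theorem weightedGram_posDef (hforced : (forcedDesign hdK Φ - 1).PosSemidef) {w : Fin K → ℝ}
    (hw : 0 ≤ w) (hw1 : ∀ i : Fin d, 1 ≤ w (Fin.castLE hdK i)) : (weightedGram Φ w).PosDef := by
  refine PosDef.of_dotProduct_mulVec_pos (weightedGram_posSemidef Φ hw).isHermitian fun v hv => ?_
  calc 0 < star v ⬝ᵥ v := dotProduct_star_self_pos_iff.2 hv
    _ ≤ star v ⬝ᵥ (weightedGram Φ w *ᵥ v) :=
        dotProduct_self_le_dotProduct_weightedGram_mulVec_self hforced hw hw1 v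

variable {a : ℕ → Fin K}

theorem designMatrix_posDef (hforced : (forcedDesign hdK Φ - 1).PosSemidef)
    (ha : ∀ i : Fin d, a i = Fin.castLE hdK i) {n : ℕ} (hn : d ≤ n) :
    (designMatrix Φ a n).PosDef := by
  rw [designMatrix_eq_weightedGram]
  exact weightedGram_posDef hforced (fun i => Nat.cast_nonneg _)
    fun i => by exact_mod_cast one_le_playCount_castLE ha hn i

theorem dotProduct_self_le_sq_weightedNorm_designMatrix
    (hforced : (forcedDesign hdK Φ - 1).PosSemidef)
    (ha : ∀ i : Fin d, a i = Fin.castLE hdK i) {n : ℕ} (hn : d ≤ n) (v : Fin d → ℝ) :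
    v ⬝ᵥ v ≤ weightedNorm (designMatrix Φ a n) v ^ 2 := by
  rw [sq_weightedNorm (designMatrix_posDef hforced ha hn).posSemidef, designMatrix_eq_weightedGram]
  exact dotProduct_self_le_dotProduct_weightedGram_mulVec_self hforced (fun i => Nat.cast_nonneg _)
    (fun i => by exact_mod_cast one_le_playCount_castLE ha hn i) v

end ForcedDesign

section Net

variable {ι : Type*} [Fintype ι]

open scoped MatrixOrder in
theorem exists_isUnit_sq_weightedNorm_eq [DecidableEq ι] {V : Matrix ι ι ℝ} (hV : V.PosDef) :
    ∃ B : Matrix ι ι ℝ, IsUnit B ∧ ∀ v, weightedNorm V v ^ 2 = (B *ᵥ v) ⬝ᵥ (B *ᵥ v) := by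
  obtain ⟨B, hB⟩ := CStarAlgebra.nonneg_iff_eq_star_mul_self.mp hV.posSemidef.nonneg
  rw [star_eq_conjTranspose, conjTranspose_eq_transpose_of_trivial] at hB
  refine ⟨B, isUnit_of_mul_isUnit_right (hB ▸ hV.isUnit), fun v => ?_⟩
  rw [sq_weightedNorm hV.posSemidef, hB, ← mulVec_mulVec, dotProduct_mulVec v, vecMul_transpose]

theorem card_piFinset_Icc_neg [DecidableEq ι] (M : ℕ) :
    (Fintype.piFinset fun _ : ι => Finset.Icc (-(M : ℤ)) M).card
      = (2 * M + 1) ^ Fintype.card ι := by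
  rw [Fintype.card_piFinset, Finset.prod_const, Finset.card_univ, Int.card_Icc]
  congr 1
  omega

theorem exists_finset_net_of_posDef {V₀ : Matrix ι ι ℝ} (hV₀ : V₀.PosDef) (M : ℕ) :
    ∃ N : Finset (ι → ℝ), N.card ≤ (2 * M + 1) ^ Fintype.card ι ∧ ∀ V : Matrix ι ι ℝ,
      (∀ v, weightedNorm V₀ v ^ 2 ≤ weightedNorm V v ^ 2) →
      (∀ v, weightedNorm V v ^ 2 ≤ 2 * weightedNorm V₀ v ^ 2) →
      ∀ v, weightedNorm V v ≤ M → ∃ l ∈ N, weightedNorm V (l - v) ≤ √(Fintype.card ι / 2) := by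
  classical
  obtain ⟨B, hB, hBV₀⟩ := exists_isUnit_sq_weightedNorm_eq hV₀
  refine ⟨(Fintype.piFinset fun _ => Finset.Icc (-(M : ℤ)) M).image
      fun p => B⁻¹ *ᵥ fun i => (p i : ℝ),
    Finset.card_image_le.trans (card_piFinset_Icc_neg M).le, fun V hlow hupp v hv => ?_⟩
  have hvM : (B *ᵥ v) ⬝ᵥ (B *ᵥ v) ≤ (M : ℝ) ^ 2 := by
    rw [← hBV₀]
    exact (hlow v).trans (pow_le_pow_left₀ (weightedNorm_nonneg V v) hv 2)
  obtain ⟨p, hpM, hp⟩ := exists_int_sq_weightedNorm_inv_mulVec_sub_le hB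
    (fun v => hBV₀ v ▸ hupp v) hvM
  refine ⟨_, Finset.mem_image_of_mem _ (Fintype.mem_piFinset.2 fun i => Finset.mem_Icc.2 ?_),
    Real.le_sqrt_of_sq_le hp⟩
  exact abs_le.1 (by exact_mod_cast hpM i)

theorem exists_finset_net {V₀ : Matrix ι ι ℝ} (hV₀ : V₀.PosSemidef) (M : ℕ) :
    ∃ N : Finset (ι → ℝ), N.card ≤ (2 * M + 1) ^ Fintype.card ι ∧ ∀ V : Matrix ι ι ℝ, V.PosDef →
      (∀ v, weightedNorm V₀ v ^ 2 ≤ weightedNorm V v ^ 2) →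
      (∀ v, weightedNorm V v ^ 2 ≤ 2 * weightedNorm V₀ v ^ 2) →
      ∀ v, weightedNorm V v ≤ M → ∃ l ∈ N, weightedNorm V (l - v) ≤ √(Fintype.card ι / 2) := by
  by_cases hV₀' : V₀.PosDef
  · obtain ⟨N, hcard, hN⟩ := exists_finset_net_of_posDef hV₀' M
    exact ⟨N, hcard, fun V _ => hN V⟩
  · refine ⟨∅, Nat.zero_le _, fun V hV _ hupp => absurd ?_ hV₀'⟩
    refine PosDef.of_dotProduct_mulVec_pos hV₀.isHermitian fun v hv => ?_
    have hpos := hV.dotProduct_mulVec_pos hv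
    have hle := hupp v
    rw [sq_weightedNorm hV.posSemidef, sq_weightedNorm hV₀] at hle
    rw [star_trivial] at hpos ⊢
    linarith

end Net

section DyadicLevels

/-- The numbers `0, 1, 2, 4, …, 2 ^ J`, to which the play counts up to `2 ^ (J + 1)` are rounded
down. -/
def dyadicLevels (J : ℕ) : Finset ℕ :=
  insert 0 ((Finset.range (J + 1)).image (2 ^ ·))

theorem card_dyadicLevels_le (J : ℕ) : (dyadicLevels J).card ≤ J + 2 := by
  refine (Finset.card_insert_le _ _).trans (Nat.succ_le_succ ?_)
  exact Finset.card_image_le.trans (Finset.card_range _).le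

theorem exists_mem_dyadicLevels {c n : ℕ} (hcn : c ≤ n) :
    ∃ w ∈ dyadicLevels (Nat.log 2 n), w ≤ c ∧ c ≤ 2 * w := by
  rcases Nat.eq_zero_or_pos c with rfl | hc
  · exact ⟨0, Finset.mem_insert_self _ _, le_rfl, le_rfl⟩
  · refine ⟨2 ^ Nat.log 2 c, Finset.mem_insert_of_mem (Finset.mem_image_of_mem _ ?_),
      Nat.pow_log_le_self 2 hc.ne', ?_⟩
    · exact Finset.mem_range.2 (Nat.lt_succ_of_le (Nat.log_mono_right hcn))
    · rw [← pow_succ']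
      exact (Nat.lt_pow_succ_log_self one_lt_two c).le

end DyadicLevels

section GridCost

variable {K d : ℕ} {ℓ : ℝ} {J : ℕ}

/-- The half-width of the cube of lattice points used when the number of plays has binary logarithm
`J`, at confidence level `exp (-ℓ)`. The leading constant is large enough for the cube to contain
the self-normalized ellipsoid. -/
noncomputable def gridRadius (K d : ℕ) (ℓ : ℝ) (J : ℕ) : ℕ :=
  ⌈(2 * K + 6 + 11 * d : ℝ) * √(J + 2 + ℓ)⌉₊

/-- The logarithm of the number of tilts used when the number of plays has binary logarithm `J`,
plus `2 log (J + 2)` for the union bound over `J`. -/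
noncomputable def gridCost (K d : ℕ) (ℓ : ℝ) (J : ℕ) : ℝ :=
  (K + 2) * Real.log (J + 2) + d * Real.log (2 * gridRadius K d ℓ J + 1)

/-- The squared radius of the self-normalized confidence ellipsoid for unit noise when the number
of plays has binary logarithm `J`, at confidence level `exp (-ℓ)`. -/
noncomputable def selfNormalizedRadiusSq (K d : ℕ) (ℓ : ℝ) (J : ℕ) : ℝ :=
  2 * ℓ + 2 * gridCost K d ℓ J + d / 2

theorem gridCost_nonneg (K d : ℕ) (ℓ : ℝ) (J : ℕ) : 0 ≤ gridCost K d ℓ J := by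
  have hJ : 0 ≤ Real.log (J + 2) := Real.log_nonneg (by linarith [J.cast_nonneg (α := ℝ)])
  have hM : 0 ≤ Real.log (2 * gridRadius K d ℓ J + 1) := Real.log_nonneg (by simp)
  unfold gridCost
  positivity

theorem exp_neg_gridCost (K d : ℕ) (ℓ : ℝ) (J : ℕ) : Real.exp (-gridCost K d ℓ J)
    = (((J : ℝ) + 2) ^ (K + 2) * (2 * gridRadius K d ℓ J + 1) ^ d)⁻¹ := by
  rw [Real.exp_neg, gridCost, Real.exp_add, ← Nat.cast_ofNat (n := 2), ← Nat.cast_add K,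
    Real.exp_nat_mul, Real.exp_nat_mul, Real.exp_log (by positivity), Real.exp_log (by positivity)]

theorem two_mul_gridRadius_add_one_le (K d : ℕ) (hℓ : 0 ≤ ℓ) (J : ℕ) :
    (2 * gridRadius K d ℓ J + 1 : ℝ) ≤ (2 * (2 * K + 6 + 11 * d) + 3) * √(J + 2 + ℓ) := by
  have hsqrt : (1 : ℝ) ≤ √(J + 2 + ℓ) :=
    Real.one_le_sqrt.2 (by linarith [J.cast_nonneg (α := ℝ)])
  have hceil := (Nat.ceil_lt_add_one
    (show 0 ≤ (2 * K + 6 + 11 * d : ℝ) * √(J + 2 + ℓ) by positivity)).le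
  rw [← gridRadius] at hceil
  linarith

theorem gridCost_le (K d : ℕ) (hℓ : 0 ≤ ℓ) (J : ℕ) :
    gridCost K d ℓ J ≤ (K + 2 + d * (2 * (2 * K + 6 + 11 * d) + 3)) * (J + 2 + ℓ) := by
  have hlogJ : Real.log (J + 2) ≤ J + 2 + ℓ := by
    linarith [Real.log_le_sub_one_of_pos (show (0 : ℝ) < J + 2 by positivity)]
  have hsqrt : √(J + 2 + ℓ) ≤ J + 2 + ℓ :=
    Real.sqrt_le_self_iff.2 (Or.inr (by linarith [J.cast_nonneg (α := ℝ)]))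
  have hlogM : Real.log (2 * gridRadius K d ℓ J + 1) ≤
      (2 * (2 * K + 6 + 11 * d) + 3) * (J + 2 + ℓ) := by
    refine (Real.log_le_self (by positivity)).trans ?_
    exact (two_mul_gridRadius_add_one_le K d hℓ J).trans (by gcongr)
  rw [gridCost, add_mul (K + 2 : ℝ), mul_assoc (d : ℝ)]
  gcongr

theorem selfNormalizedRadiusSq_le_sq_gridRadius (K d : ℕ) (hℓ : 0 ≤ ℓ) (J : ℕ) :
    selfNormalizedRadiusSq K d ℓ J ≤ (gridRadius K d ℓ J : ℝ) ^ 2 := by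
  set c : ℝ := 2 * K + 6 + 11 * d with hc
  set y : ℝ := J + 2 + ℓ
  have hJ : (0 : ℝ) ≤ J := J.cast_nonneg
  have hd : (0 : ℝ) ≤ d := d.cast_nonneg
  have hK : (0 : ℝ) ≤ K := K.cast_nonneg
  have hy1 : 1 ≤ y := by linarith [hJ]
  have hc1 : 1 ≤ c := by linarith [hc, hK, hd]
  calc selfNormalizedRadiusSq K d ℓ J
      ≤ 2 * y + 2 * ((K + 2 + d * (2 * c + 3)) * y) + d / 2 * y := by
        rw [selfNormalizedRadiusSq]
        gcongr
        · linarith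
        · exact gridCost_le K d hℓ J
        · exact le_mul_of_one_le_right (by positivity) hy1
    _ = (2 * K + 6 + 13 / 2 * d + 4 * d * c) * y := by ring
    _ ≤ c * c * y := by gcongr; nlinarith [hc1, hd]
    _ = (c * √y) ^ 2 := by rw [mul_pow, Real.sq_sqrt (by linarith), sq c]
    _ ≤ (gridRadius K d ℓ J : ℝ) ^ 2 := by gcongr; exact Nat.le_ceil _

theorem mul_exp_neg_gridCost_le (K d : ℕ) (ℓ : ℝ) (J : ℕ) {N : ℕ}
    (hN : N ≤ (J + 2) ^ K * (2 * gridRadius K d ℓ J + 1) ^ d) :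
    N * Real.exp (-gridCost K d ℓ J) ≤ 1 / ((J + 1) * (J + 2)) := by
  have hN' : (N : ℝ) ≤ ((J : ℝ) + 2) ^ K * (2 * gridRadius K d ℓ J + 1) ^ d := by
    exact_mod_cast hN
  calc N * Real.exp (-gridCost K d ℓ J)
      ≤ ((J : ℝ) + 2) ^ K * (2 * gridRadius K d ℓ J + 1) ^ d * Real.exp (-gridCost K d ℓ J) := by
        gcongr
    _ = 1 / ((J + 2) * (J + 2)) := by rw [exp_neg_gridCost, pow_add]; field_simp
    _ ≤ 1 / ((J + 1) * (J + 2)) := by gcongr; norm_num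

theorem tsum_ofReal_inv_mul_le_one :
    ∑' J : ℕ, ENNReal.ofReal (1 / (((J : ℝ) + 1) * (J + 2))) ≤ 1 := by
  refine ENNReal.tsum_le_of_sum_range_le fun n => ?_
  have htelescope : ∑ J ∈ Finset.range n, 1 / (((J : ℝ) + 1) * (J + 2)) = 1 - 1 / (n + 1) := by
    induction n with
    | zero => norm_num
    | succ n ih => rw [Finset.sum_range_succ, ih]; push_cast; field_simp; ring
  rw [← ENNReal.ofReal_sum_of_nonneg fun J _ => by positivity, htelescope, ← ENNReal.ofReal_one]
  exact ENNReal.ofReal_le_ofReal (sub_le_self _ (by positivity))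

end GridCost

section Concentration

variable {K d : ℕ}

theorem dotProduct_responseVector_sub_half_sq_weightedNorm (Φ : Matrix (Fin K) (Fin d) ℝ) {R : ℝ}
    (hR : R ≠ 0) (l : Fin d → ℝ) (a : ℕ → Fin K) (e : ℕ → ℝ) (n : ℕ) :
    l ⬝ᵥ (R⁻¹ • responseVector Φ a e n) - weightedNorm (designMatrix Φ a n) l ^ 2 / 2
      = tiltExponent R (fun i => R⁻¹ * (Φ i ⬝ᵥ l)) a e n := by
  have hsum : weightedNorm (designMatrix Φ a n) l ^ 2
      = ∑ m ∈ Finset.range n, (Φ (a m) ⬝ᵥ l) ^ 2 := by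
    rw [sq_weightedNorm_designMatrix,
      sum_range_comp_eq_sum_playCount_smul a n fun i => (Φ i ⬝ᵥ l) ^ 2]
    simp only [nsmul_eq_mul]
  rw [hsum, responseVector, dotProduct_smul, dotProduct_sum, smul_eq_mul, tiltExponent,
    Finset.mul_sum, Finset.sum_div, ← Finset.sum_sub_distrib]
  refine Finset.sum_congr rfl fun m _ => ?_
  rw [dotProduct_smul, smul_eq_mul, dotProduct_comm l]
  field_simp

theorem exists_finset_net_designMatrix (Φ : Matrix (Fin K) (Fin d) ℝ) (ℓ : ℝ) (J : ℕ) :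
    ∃ N : Finset (Fin d → ℝ),
      N.card ≤ (J + 2) ^ K * (2 * gridRadius K d ℓ J + 1) ^ d ∧
      ∀ (a : ℕ → Fin K) (n : ℕ), Nat.log 2 n = J → (designMatrix Φ a n).PosDef →
        ∀ v, weightedNorm (designMatrix Φ a n) v ≤ gridRadius K d ℓ J →
          ∃ l ∈ N, weightedNorm (designMatrix Φ a n) (l - v) ≤ √(d / 2) := by
  classical
  choose N hcard hN using fun w : Fin K → ℕ => exists_finset_net
    (weightedGram_posSemidef Φ (w := fun i => (w i : ℝ)) fun i => Nat.cast_nonneg _)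
    (gridRadius K d ℓ J)
  rw [Fintype.card_fin] at hcard hN
  refine ⟨(Fintype.piFinset fun _ => dyadicLevels J).biUnion N, ?_, ?_⟩
  · refine (Finset.card_biUnion_le_card_mul _ _ _ fun w _ => hcard w).trans ?_
    gcongr
    rw [Fintype.card_piFinset, Finset.prod_const, Finset.card_univ, Fintype.card_fin]
    exact Nat.pow_le_pow_left (card_dyadicLevels_le J) K
  · rintro a n rfl hV v hv
    choose w hw hlow hupp using fun i =>
      exists_mem_dyadicLevels (Nat.count_le (p := (a · = i)) (n := n))
    have hgram := fun u => sq_weightedNorm_weightedGram Φ (w := fun i => (w i : ℝ))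
      (fun i => Nat.cast_nonneg _) u
    obtain ⟨l, hl, hlv⟩ := hN w (designMatrix Φ a n) hV (fun u => by
      rw [hgram, sq_weightedNorm_designMatrix]
      gcongr with i
      exact hlow i) (fun u => by
      rw [hgram, sq_weightedNorm_designMatrix, Finset.mul_sum]
      simp only [← mul_assoc]
      gcongr with i
      exact_mod_cast hupp i) v hv
    exact ⟨l, Finset.mem_biUnion.2 ⟨w, Fintype.mem_piFinset.2 hw, hl⟩, hlv⟩

/-- The noise `e` stays in the self-normalized ellipsoids at confidence level `exp (-ℓ)` from the
end of the forced exploration phase on. -/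
def NoiseControlled (Φ : Matrix (Fin K) (Fin d) ℝ) (R ℓ : ℝ) (a : ℕ → Fin K) (e : ℕ → ℝ) : Prop :=
  ∀ n, d ≤ n → weightedNorm (designMatrix Φ a n)⁻¹ (responseVector Φ a e n)
    ≤ R * √(selfNormalizedRadiusSq K d ℓ (Nat.log 2 n))

theorem noiseControlled_of_forall_tiltExponent_lt {Φ : Matrix (Fin K) (Fin d) ℝ} {R ℓ : ℝ}
    (hR : 0 < R) (hℓ : 0 ≤ ℓ) {a : ℕ → Fin K} {e : ℕ → ℝ}
    (hV : ∀ n, d ≤ n → (designMatrix Φ a n).PosDef) {N : ℕ → Finset (Fin d → ℝ)}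
    (hN : ∀ J n, Nat.log 2 n = J → (designMatrix Φ a n).PosDef →
      ∀ v, weightedNorm (designMatrix Φ a n) v ≤ gridRadius K d ℓ J →
        ∃ l ∈ N J, weightedNorm (designMatrix Φ a n) (l - v) ≤ √(d / 2))
    (hlt : ∀ J, ∀ l ∈ N J, ∀ n,
      tiltExponent R (fun i => R⁻¹ * (Φ i ⬝ᵥ l)) a e n < ℓ + gridCost K d ℓ J) :
    NoiseControlled Φ R ℓ a e := by
  intro n hn
  set J := Nat.log 2 n
  have hcost := gridCost_nonneg K d ℓ J
  have hnet : ∀ v, weightedNorm (designMatrix Φ a n) v ≤ √(selfNormalizedRadiusSq K d ℓ J) →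
      ∃ l ∈ N J, weightedNorm (designMatrix Φ a n) (l - v) ≤ √(d / 2) := fun v hv =>
    hN J n rfl (hV n hn) v <| hv.trans <| (Real.sqrt_le_left (Nat.cast_nonneg _)).2
      (selfNormalizedRadiusSq_le_sq_gridRadius K d hℓ J)
  have hscaled : weightedNorm (designMatrix Φ a n)⁻¹ (R⁻¹ • responseVector Φ a e n)
      ≤ √(selfNormalizedRadiusSq K d ℓ J) := by
    refine weightedNorm_inv_le_of_net (hV n hn) (Real.sqrt_nonneg _)
      (Real.sqrt_le_sqrt ?_) hnet fun l hl => ?_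
    · rw [selfNormalizedRadiusSq]
      linarith
    · rw [dotProduct_responseVector_sub_half_sq_weightedNorm Φ hR.ne', selfNormalizedRadiusSq,
        Real.sq_sqrt (by positivity), Real.sq_sqrt (by positivity)]
      linarith [hlt J l hl n]
  rwa [weightedNorm_smul, abs_of_pos (inv_pos.2 hR), inv_mul_le_iff₀ hR] at hscaled

theorem HasSubGaussianNoise.measure_exists_tilt_le {Ω ι β : Type*} {m0 : MeasurableSpace Ω}
    [MeasurableSpace ι] [Finite ι] [MeasurableSingletonClass ι] {ℱ : Filtration ℕ m0}
    {P : Measure Ω} [IsProbabilityMeasure P] {A : ℕ → Ω → ι} {η : ℕ → Ω → ℝ} {R : ℝ}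
    (h : HasSubGaussianNoise ℱ P A η R) (tilt : β → ι → ℝ) {N : ℕ → Finset β} {c : ℕ → ℝ}
    (hc : ∀ J, (N J).card * Real.exp (-c J) ≤ 1 / (((J : ℝ) + 1) * (J + 2))) (ℓ : ℝ) :
    P {ω | ∃ J, ∃ l ∈ N J, ∃ n, ℓ + c J ≤ tiltExponent R (tilt l) (A · ω) (η · ω) n}
      ≤ ENNReal.ofReal (Real.exp (-ℓ)) := by
  calc P {ω | ∃ J, ∃ l ∈ N J, ∃ n, ℓ + c J ≤ tiltExponent R (tilt l) (A · ω) (η · ω) n}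
      = P (⋃ J, ⋃ l ∈ N J,
          {ω | ∃ n, ℓ + c J ≤ tiltExponent R (tilt l) (A · ω) (η · ω) n}) := by
        congr 1
        ext ω
        simp only [Set.mem_ofPred_eq, Set.mem_iUnion, exists_prop]
    _ ≤ ∑' J, ∑ l ∈ N J, P {ω | ∃ n, ℓ + c J ≤ tiltExponent R (tilt l) (A · ω) (η · ω) n} :=
        (measure_iUnion_le _).trans (ENNReal.tsum_le_tsum fun J => measure_biUnion_finset_le _ _)
    _ ≤ ∑' J, ∑ _l ∈ N J, ENNReal.ofReal (Real.exp (-(ℓ + c J))) :=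
        ENNReal.tsum_le_tsum fun J => Finset.sum_le_sum fun l _ =>
          h.measure_exists_le_tiltExponent_le _ _
    _ ≤ ∑' J : ℕ, ENNReal.ofReal (Real.exp (-ℓ)) *
          ENNReal.ofReal (1 / (((J : ℝ) + 1) * (J + 2))) := by
        refine ENNReal.tsum_le_tsum fun J => ?_
        rw [Finset.sum_const, nsmul_eq_mul, ← ENNReal.ofReal_natCast,
          ← ENNReal.ofReal_mul (Nat.cast_nonneg _), ← ENNReal.ofReal_mul (Real.exp_pos _).le,
          neg_add, Real.exp_add, mul_left_comm]
        exact ENNReal.ofReal_le_ofReal (mul_le_mul_of_nonneg_left (hc J) (Real.exp_pos _).le)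
    _ ≤ ENNReal.ofReal (Real.exp (-ℓ)) := by
        rw [ENNReal.tsum_mul_left]
        exact mul_le_of_le_one_right' tsum_ofReal_inv_mul_le_one

theorem IsOFULRun.one_sub_le_measureReal {Ω : Type*} [MeasurableSpace Ω] {P : Measure Ω}
    [IsProbabilityMeasure P] {hdK : d ≤ K} {Φ : Matrix (Fin K) (Fin d) ℝ} {μ : Fin K → ℝ}
    {R δ : ℝ} {A : ℕ → Ω → Fin K} {η : ℕ → Ω → ℝ} (h : IsOFULRun hdK Φ μ R δ P A η)
    (hforced : (forcedDesign hdK Φ - 1).PosSemidef) (hR : 0 < R) (hδ : 0 < δ) {S : Set Ω}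
    (hS : ∀ ω, δ < 1 → NoiseControlled Φ R (-Real.log δ) (A · ω) (η · ω) → ω ∈ S) :
    1 - δ ≤ P.real S := by
  rcases le_or_gt 1 δ with hδ1 | hδ1
  · exact (sub_nonpos.2 hδ1).trans measureReal_nonneg
  set ℓ := -Real.log δ with hℓ
  choose N hcard hN using exists_finset_net_designMatrix Φ ℓ
  set bad : Set Ω := {ω | ∃ J, ∃ l ∈ N J, ∃ n, ℓ + gridCost K d ℓ J ≤
    tiltExponent R (fun i => R⁻¹ * (Φ i ⬝ᵥ l)) (A · ω) (η · ω) n} with hbad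
  have hPbad : P.real bad ≤ δ := by
    refine ENNReal.toReal_le_of_le_ofReal hδ.le ?_
    have hexp : Real.exp (-ℓ) = δ := by rw [hℓ, neg_neg, Real.exp_log hδ]
    rw [← hexp]
    exact h.hasSubGaussianNoise.measure_exists_tilt_le (fun l i => R⁻¹ * (Φ i ⬝ᵥ l))
      (fun J => mul_exp_neg_gridCost_le K d ℓ J (hcard J)) ℓ
  have hgood : badᶜ ⊆ S := fun ω hω => hS ω hδ1 <|
    noiseControlled_of_forall_tiltExponent_lt hR (neg_nonneg.2 (Real.log_nonpos hδ.le hδ1.le))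
      (fun n hn => designMatrix_posDef hforced (h.follows ω).1 hn) (fun J => hN J _) (by
        simpa only [hbad, Set.mem_compl_iff, Set.mem_ofPred_eq, not_exists, not_and, not_le]
          using hω)
  have huniv : (Set.univ : Set Ω) ⊆ S ∪ bad := fun ω _ =>
    (em (ω ∈ bad)).symm.imp (fun hω => hgood hω) id
  have hone : 1 ≤ P.real S + P.real bad := by
    rw [← probReal_univ (μ := P)]
    exact (measureReal_mono huniv).trans (measureReal_union_le _ _)
  linarith

end Concentration

section RadiusGrowth

theorem log_le_mul_sub_one_sub_log {a x : ℝ} (ha : 0 < a) (hx : 0 < x) :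
    Real.log x ≤ a * x - 1 - Real.log a := by
  have h := Real.log_le_sub_one_of_pos (mul_pos ha hx)
  rw [Real.log_mul ha.ne' hx.ne'] at h
  linarith

theorem log_one_add_le_log_add_log {d t : ℝ} (hd : 1 ≤ d) (ht : 0 ≤ t) :
    Real.log (1 + t) ≤ Real.log d + Real.log (1 + t / d) := by
  rw [← Real.log_mul (by positivity) (by positivity), mul_add, mul_div_cancel₀ _ (by positivity)]
  exact Real.log_le_log (by positivity) (by linarith)

theorem half_le_mul_log_one_add_div {d t : ℝ} (hd : 1 ≤ d) (ht : 1 ≤ t) :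
    1 / 2 ≤ d * Real.log (1 + t / d) := by
  have hlog := Real.one_sub_inv_le_log_of_pos (show 0 < 1 + t / d by positivity)
  calc (1 / 2 : ℝ) ≤ d * t / (d + t) := by
        rw [div_le_div_iff₀ (by norm_num) (by positivity)]
        nlinarith
    _ = d * (1 - (1 + t / d)⁻¹) := by field_simp; ring
    _ ≤ d * Real.log (1 + t / d) := by gcongr

variable (K : ℕ) {d : ℕ}

theorem natCast_log_two_le (hd : 0 < d) {n t : ℕ} (hn : n ≤ d + t) :
    (Nat.log 2 n : ℝ) ≤ 2 * Real.log d + 2 * Real.log (1 + t) := by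
  have hd' : (1 : ℝ) ≤ d := by exact_mod_cast hd
  have hpow : (2 : ℝ) ^ Nat.log 2 n ≤ d * (1 + t) := by
    have hle : (2 : ℝ) ^ Nat.log 2 n ≤ d + t := by
      exact_mod_cast (Nat.pow_le_pow_right two_pos (Nat.log_mono_right hn)).trans
        (Nat.pow_log_le_self 2 (by omega))
    nlinarith
  have hlog := Real.log_le_log (by positivity) hpow
  rw [Real.log_pow, Real.log_mul (by positivity) (by positivity)] at hlog
  nlinarith [Real.log_two_gt_d9, (Nat.log 2 n).cast_nonneg (α := ℝ)]

theorem two_mul_gridCost_le (d : ℕ) {ℓ : ℝ} (hℓ : 0 ≤ ℓ) (J : ℕ) :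
    2 * gridCost K d ℓ J ≤ (2 * K + 4 + d) * Real.log (J + 2) + d * Real.log (1 + ℓ)
      + 2 * d * Real.log (2 * (2 * K + 6 + 11 * d) + 3) := by
  have hJ : (0 : ℝ) ≤ J := J.cast_nonneg
  have hgrid : 2 * Real.log (2 * gridRadius K d ℓ J + 1) ≤
      2 * Real.log (2 * (2 * K + 6 + 11 * d) + 3) + (Real.log (1 + ℓ) + Real.log (J + 2)) := by
    have hlog := Real.log_le_log (by positivity) (two_mul_gridRadius_add_one_le K d hℓ J)
    rw [Real.log_mul (by positivity) (by positivity), Real.log_sqrt (by positivity)] at hlog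
    have hprod : Real.log (J + 2 + ℓ) ≤ Real.log ((1 + ℓ) * (J + 2)) :=
      Real.log_le_log (by positivity) (by nlinarith [hJ])
    rw [Real.log_mul (by positivity) (by positivity)] at hprod
    linarith
  have hmul := mul_le_mul_of_nonneg_left hgrid d.cast_nonneg
  rw [gridCost]
  linarith

theorem exists_selfNormalizedRadiusSq_le (hd : 0 < d) : ∃ C : ℝ, 0 ≤ C ∧
    ∀ ℓ : ℝ, 0 ≤ ℓ → ∀ n t : ℕ, n ≤ d + t → selfNormalizedRadiusSq K d ℓ (Nat.log 2 n) ≤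
      2 * ℓ + d * Real.log (1 + ℓ) + d / 6 * Real.log (1 + t) + C := by
  set m : ℝ := 2 * K + 4 + d with hm
  set q : ℝ := d / (12 * m) with hq
  set C : ℝ := d / 12 * (2 * Real.log d + 2) - m * (1 + Real.log q)
    + 2 * d * Real.log (2 * (2 * K + 6 + 11 * d) + 3) + d / 2 with hC
  refine ⟨max C 0, le_max_right _ _, fun ℓ hℓ n t hn => ?_⟩
  have hm0 : 0 < m := by positivity
  have hq0 : 0 < q := by positivity
  have hlogJ : m * Real.log (Nat.log 2 n + 2) ≤
      d / 12 * (2 * Real.log d + 2 * Real.log (1 + t) + 2) - m * (1 + Real.log q) :=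
    calc m * Real.log (Nat.log 2 n + 2)
        ≤ m * (q * (Nat.log 2 n + 2) - 1 - Real.log q) := by
          gcongr
          exact log_le_mul_sub_one_sub_log hq0 (by positivity)
      _ = d / 12 * (Nat.log 2 n + 2) - m * (1 + Real.log q) := by rw [hq]; field_simp; ring
      _ ≤ _ := by gcongr; exact natCast_log_two_le hd hn
  have hcost := two_mul_gridCost_le K d hℓ (Nat.log 2 n)
  rw [← hm] at hcost
  rw [selfNormalizedRadiusSq]
  linarith [le_max_left C 0, hC]

end RadiusGrowth

section RadiusConstants

variable {d t ℓ C W : ℝ}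

theorem log_exp_mul_mul_sqrt {x : ℝ} (hx : 0 < x) (c : ℝ) :
    Real.log (Real.exp c * (x * √x)) = c + 3 / 2 * Real.log x := by
  rw [Real.log_mul (by positivity) (by positivity), Real.log_exp,
    Real.log_mul (by positivity) (by positivity), Real.log_sqrt (by positivity)]
  ring

theorem radiusSq_le_of_exp_mul_le (hd : 1 ≤ d) (hℓ : 0 ≤ ℓ)
    (hW : W ≤ 2 * ℓ + d * Real.log (1 + ℓ) + d / 6 * Real.log (1 + t) + C)
    (ht : Real.exp (3 / 2 * (C / d + Real.log d)) * ((1 + ℓ) * √(1 + ℓ)) ≤ t) :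
    W ≤ 2 * ℓ + d * Real.log (1 + t / d) := by
  have ht0 : 0 < t := ht.trans_lt' (by positivity)
  have hlog : 3 / 2 * (C / d + Real.log d) + 3 / 2 * Real.log (1 + ℓ) ≤ Real.log (1 + t) := by
    rw [← log_exp_mul_mul_sqrt (by positivity)]
    exact Real.log_le_log (by positivity) (by linarith)
  have hmul := mul_le_mul_of_nonneg_left hlog (show 0 ≤ 2 / 3 * d by positivity)
  have hC : 2 / 3 * d * (3 / 2 * (C / d + Real.log d)) = C + d * Real.log d := by field_simp
  have hlogt := mul_le_mul_of_nonneg_left (log_one_add_le_log_add_log hd ht0.le)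
    (zero_le_one.trans hd)
  have hlog0 : 0 ≤ d * Real.log (1 + t) :=
    mul_nonneg (zero_le_one.trans hd) (Real.log_nonneg (by linarith))
  linarith

theorem log_le_four_mul_sqrt_sqrt {x : ℝ} (hx : 1 ≤ x) : Real.log x ≤ 4 * √√x := by
  have h := Real.log_le_sub_one_of_pos (show 0 < √√x by positivity)
  rw [Real.log_sqrt (Real.sqrt_nonneg _), Real.log_sqrt (by positivity)] at h
  linarith

theorem sq_radiusSq_sub_le_of_lt_exp_mul {c : ℝ} (hd : 0 ≤ d) (hC : 0 ≤ C) (hc : 0 ≤ c)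
    (hℓ : 0 ≤ ℓ) (ht1 : 1 ≤ t) (hℓW : 2 * ℓ ≤ W)
    (hW : W ≤ 2 * ℓ + d * Real.log (1 + ℓ) + d / 6 * Real.log (1 + t) + C)
    (ht : t < Real.exp c * ((1 + ℓ) * √(1 + ℓ))) :
    (W - 2 * ℓ) ^ 2 ≤ (5 * d + d / 6 * (1 + c) + C) ^ 2 * √(1 + ℓ) := by
  have hlogt : Real.log (1 + t) ≤ 1 + (c + 3 / 2 * Real.log (1 + ℓ)) := by
    have h2t : Real.log (1 + t) ≤ Real.log (2 * t) :=
      Real.log_le_log (by positivity) (by linarith)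
    have hlog := Real.log_le_log (by positivity) ht.le
    rw [log_exp_mul_mul_sqrt (by positivity)] at hlog
    rw [Real.log_mul (by norm_num) (by positivity)] at h2t
    linarith [Real.log_two_lt_d9]
  have hlogℓ := log_le_four_mul_sqrt_sqrt (show 1 ≤ 1 + ℓ by linarith)
  have hroot : 1 ≤ √√(1 + ℓ) := Real.one_le_sqrt.2 (Real.one_le_sqrt.2 (by linarith))
  have hupper : W - 2 * ℓ ≤ (5 * d + d / 6 * (1 + c) + C) * √√(1 + ℓ) := by
    have hd6 := mul_le_mul_of_nonneg_left hlogt (show 0 ≤ d / 6 by positivity)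
    have hdℓ := mul_le_mul_of_nonneg_left hlogℓ (show 0 ≤ 5 / 4 * d by positivity)
    have hconst := mul_le_mul_of_nonneg_left hroot (show 0 ≤ d / 6 * (1 + c) + C by positivity)
    linarith
  calc (W - 2 * ℓ) ^ 2 ≤ ((5 * d + d / 6 * (1 + c) + C) * √√(1 + ℓ)) ^ 2 := by gcongr
    _ = (5 * d + d / 6 * (1 + c) + C) ^ 2 * √(1 + ℓ) := by
      rw [mul_pow, Real.sq_sqrt (Real.sqrt_nonneg _)]

theorem radiusSq_le_mul (hd : 1 ≤ d) (hC : 0 ≤ C) (hℓ : 0 ≤ ℓ) (ht : 1 ≤ t)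
    (hW : W ≤ 2 * ℓ + d * Real.log (1 + ℓ) + d / 6 * Real.log (1 + t) + C) :
    W ≤ (2 + d + d * Real.log d + 2 * C) * (2 * ℓ + d * Real.log (1 + t / d)) := by
  set D := d * Real.log (1 + t / d)
  have hhalf : 1 / 2 ≤ D := half_le_mul_log_one_add_div hd ht
  have hlogℓ : d * Real.log (1 + ℓ) ≤ d * ℓ := by
    gcongr
    linarith [Real.log_le_sub_one_of_pos (show 0 < 1 + ℓ by linarith)]
  have hlogt : d / 6 * Real.log (1 + t) ≤ d / 6 * (Real.log d + Real.log (1 + t / d)) := by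
    gcongr
    exact log_one_add_le_log_add_log hd (by linarith)
  have hlogd : 0 ≤ d * Real.log d := mul_nonneg (by linarith) (Real.log_nonneg hd)
  have hconst : (d * Real.log d + 2 * C) * (1 / 2) ≤ (d * Real.log d + 2 * C) * D := by gcongr
  have hℓ' : 0 ≤ (d * Real.log d + 2 * C) * ℓ := by positivity
  have hdℓ : 0 ≤ d * ℓ := by positivity
  have hdD : 0 ≤ d * D := by positivity
  linarith

/-- Constants comparing the squared self-normalized radius after `n ≤ d + t` plays with
`2 ℓ + d log (1 + t / d)`, which for `ℓ = log (1 / δ)` is the squared radius `β_t(δ) / R ^ 2` of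
OFUL: it is smaller from time `C₁ (1 + ℓ) ^ (3 / 2)` on, before that time it exceeds `2 ℓ` by at
most `C₂ ^ (1 / 2) (1 + ℓ) ^ (1 / 4)`, and it is never larger by more than the factor `C₀`. -/
structure RadiusConstants (K d : ℕ) (C₀ C₁ C₂ : ℝ) : Prop where
  one_le : 1 ≤ C₀
  pos₁ : 0 < C₁
  pos₂ : 0 < C₂
  le_of_late {ℓ : ℝ} {n t : ℕ} : 0 ≤ ℓ → 1 ≤ t → n ≤ d + t → C₁ * ((1 + ℓ) * √(1 + ℓ)) ≤ t →
    selfNormalizedRadiusSq K d ℓ (Nat.log 2 n) ≤ 2 * ℓ + d * Real.log (1 + t / d)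
  sq_sub_le_of_early {ℓ : ℝ} {n t : ℕ} : 0 ≤ ℓ → 1 ≤ t → n ≤ d + t →
    t < C₁ * ((1 + ℓ) * √(1 + ℓ)) →
    (selfNormalizedRadiusSq K d ℓ (Nat.log 2 n) - 2 * ℓ) ^ 2 ≤ C₂ * √(1 + ℓ)
  le_mul {ℓ : ℝ} {n t : ℕ} : 0 ≤ ℓ → 1 ≤ t → n ≤ d + t →
    selfNormalizedRadiusSq K d ℓ (Nat.log 2 n) ≤ C₀ * (2 * ℓ + d * Real.log (1 + t / d))

theorem two_mul_le_selfNormalizedRadiusSq (K d : ℕ) (ℓ : ℝ) (J : ℕ) :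
    2 * ℓ ≤ selfNormalizedRadiusSq K d ℓ J := by
  rw [selfNormalizedRadiusSq]
  linarith [gridCost_nonneg K d ℓ J, d.cast_nonneg (α := ℝ)]

theorem exists_radiusConstants (K : ℕ) {d : ℕ} (hd : 0 < d) :
    ∃ C₀ C₁ C₂ : ℝ, RadiusConstants K d C₀ C₁ C₂ := by
  obtain ⟨C, hC, hW⟩ := exists_selfNormalizedRadiusSq_le K hd
  have hd1 : (1 : ℝ) ≤ d := by exact_mod_cast hd
  have hlogd : 0 ≤ Real.log d := Real.log_nonneg hd1
  refine ⟨2 + d + d * Real.log d + 2 * C, Real.exp (3 / 2 * (C / d + Real.log d)),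
    (5 * d + d / 6 * (1 + 3 / 2 * (C / d + Real.log d)) + C) ^ 2, ?_, Real.exp_pos _,
    by positivity, fun hℓ _ hn => radiusSq_le_of_exp_mul_le hd1 hℓ (hW _ hℓ _ _ hn),
    fun hℓ ht hn => sq_radiusSq_sub_le_of_lt_exp_mul d.cast_nonneg hC (by positivity) hℓ
      (by exact_mod_cast ht) (two_mul_le_selfNormalizedRadiusSq K d _ _) (hW _ hℓ _ _ hn),
    fun hℓ ht hn => radiusSq_le_mul hd1 hC hℓ (by exact_mod_cast ht) (hW _ hℓ _ _ hn)⟩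
  linarith [mul_nonneg d.cast_nonneg hlogd]

end RadiusConstants

section ModelEstimates

variable {K d : ℕ} {Φ : Matrix (Fin K) (Fin d) ℝ} {α μ : Fin K → ℝ} {k : Fin K}

theorem IsModelEstimate.add_mulVec {θ : Fin d → ℝ} (h : IsModelEstimate Φ α μ θ)
    (v : Fin d → ℝ) : IsModelEstimate Φ α (μ + Φ *ᵥ v) (θ + v) := fun θ' => by
  have hθ' := h (θ' - v)
  simp only [mulVec_add, mulVec_sub, Pi.add_apply, Pi.sub_apply] at hθ' ⊢
  convert hθ' using 4 <;> ring

theorem isModelEstimate_of_weightedGram_mulVec_eq (hα : 0 ≤ α) {θ : Fin d → ℝ}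
    (hθ : weightedGram Φ α *ᵥ θ = ∑ i, (α i * μ i) • Φ i) : IsModelEstimate Φ α μ θ := by
  intro θ'
  have hcross : ∑ i, α i * ((Φ i ⬝ᵥ θ - μ i) * (Φ i ⬝ᵥ (θ' - θ))) = 0 := by
    have hinner := congrArg ((θ' - θ) ⬝ᵥ ·) hθ
    simp only [dotProduct_weightedGram_mulVec, dotProduct_sum, dotProduct_smul,
      smul_eq_mul] at hinner
    rw [← sub_eq_zero, ← Finset.sum_sub_distrib] at hinner
    rw [← hinner]
    refine Finset.sum_congr rfl fun i _ => ?_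
    rw [dotProduct_comm (θ' - θ) (Φ i)]
    ring
  calc ∑ i, α i * ((Φ *ᵥ θ) i - μ i) ^ 2
      ≤ ∑ i, α i * ((Φ *ᵥ θ) i - μ i) ^ 2 + ∑ i, α i * (Φ i ⬝ᵥ (θ' - θ)) ^ 2 :=
        le_add_of_nonneg_right <| Finset.sum_nonneg fun i _ => mul_nonneg (hα i) (sq_nonneg _)
    _ = ∑ i, α i * ((Φ *ᵥ θ) i - μ i) ^ 2
          + 2 * ∑ i, α i * ((Φ i ⬝ᵥ θ - μ i) * (Φ i ⬝ᵥ (θ' - θ)))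
          + ∑ i, α i * (Φ i ⬝ᵥ (θ' - θ)) ^ 2 := by rw [hcross, mul_zero, add_zero]
    _ = ∑ i, α i * ((Φ *ᵥ θ') i - μ i) ^ 2 := by
        rw [Finset.mul_sum, ← Finset.sum_add_distrib, ← Finset.sum_add_distrib]
        refine Finset.sum_congr rfl fun i _ => ?_
        simp only [mulVec, dotProduct_sub]
        ring

theorem exists_samplingDistribution_isModelEstimate {w : Fin K → ℝ} (hw : 0 ≤ w)
    (hw0 : 0 < ∑ i, w i) (hgram : IsUnit (weightedGram Φ w)) (μ : Fin K → ℝ) :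
    ∃ α ∈ samplingDistributions Φ,
      IsModelEstimate Φ α μ ((weightedGram Φ w)⁻¹ *ᵥ ∑ i, (w i * μ i) • Φ i) := by
  set c := (∑ i, w i)⁻¹ with hc
  have hc0 : 0 < c := inv_pos.2 hw0
  have hcw : 0 ≤ c • w := smul_nonneg hc0.le hw
  refine ⟨c • w, ⟨⟨hcw, ?_⟩, ?_⟩, isModelEstimate_of_weightedGram_mulVec_eq hcw ?_⟩
  · simp only [Pi.smul_apply, smul_eq_mul]
    rw [← Finset.mul_sum, hc, inv_mul_cancel₀ hw0.ne']
  · change IsUnit (weightedGram Φ (c • w))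
    rw [weightedGram_smul]
    exact hgram.smul (Units.mk0 c hc0.ne')
  · rw [weightedGram_smul, smul_mulVec, mulVec_inv_mulVec hgram, Finset.smul_sum]
    exact Finset.sum_congr rfl fun i _ => by
      rw [smul_smul, Pi.smul_apply, smul_eq_mul, mul_assoc]

-- Moving `μ` by `-c Φ (φ_k - φ_i)` keeps it in the region and shifts every model estimate by
-- `-c (φ_k - φ_i)`, whatever the sampling distribution.
theorem exists_pos_le_dotProduct_sub (hμ : μ ∈ interior (robustObservationRegion Φ k))
    {i : Fin K} (hi : i ≠ k) : ∃ Δ : ℝ, 0 < Δ ∧ ∀ α ∈ samplingDistributions Φ, ∀ θ,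
      IsModelEstimate Φ α μ θ → Δ ≤ Φ k ⬝ᵥ θ - Φ i ⬝ᵥ θ := by
  set v := Φ k - Φ i
  by_cases hv0 : v = 0
  · refine ⟨1, one_pos, fun α hα θ hθ => absurd ((interior_subset hμ).2 α hα θ hθ i hi) ?_⟩
    simp only [mulVec, sub_eq_zero.1 hv0, lt_irrefl, not_false_eq_true]
  have hmoved : ∀ᶠ c : ℝ in nhds 0, μ + Φ *ᵥ ((-c) • v) ∈ robustObservationRegion Φ k := by
    have hcont : Continuous fun c : ℝ => μ + Φ *ᵥ ((-c) • v) := by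
      simp only [mulVec_smul]
      fun_prop
    exact (hcont.tendsto' 0 μ (by
      simp only [neg_zero, zero_smul, mulVec_zero, add_zero])).eventually
        (mem_interior_iff_mem_nhds.1 hμ)
  obtain ⟨c, hc, hc0⟩ := ((hmoved.filter_mono nhdsWithin_le_nhds).and
    (self_mem_nhdsWithin (s := Set.Ioi (0 : ℝ)))).exists
  have hvv : 0 < v ⬝ᵥ v := (dotProduct_self_star_nonneg v).lt_of_ne'
    (mt dotProduct_self_eq_zero.1 hv0)
  refine ⟨c * (v ⬝ᵥ v), mul_pos hc0 hvv, fun α hα θ hθ => ?_⟩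
  have hlt := hc.2 α hα _ (hθ.add_mulVec _) i hi
  simp only [mulVec, dotProduct_add, dotProduct_smul, smul_eq_mul] at hlt
  have hsplit : v ⬝ᵥ v = Φ k ⬝ᵥ v - Φ i ⬝ᵥ v := by rw [← sub_dotProduct]
  rw [hsplit]
  linarith

theorem exists_isModelGap (hμ : μ ∈ interior (robustObservationRegion Φ k)) :
    ∃ Δ : ℝ, 0 < Δ ∧ IsModelGap Φ μ k Δ := by
  have hsmall : ∀ i, ∀ᶠ Δ : ℝ in nhdsWithin 0 (Set.Ioi 0), i ≠ k →
      ∀ α ∈ samplingDistributions Φ, ∀ θ, IsModelEstimate Φ α μ θ →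
        Δ ≤ Φ k ⬝ᵥ θ - Φ i ⬝ᵥ θ := by
    intro i
    by_cases hi : i = k
    · exact .of_forall fun _ h => absurd hi h
    obtain ⟨Δ₀, hΔ₀, hgap⟩ := exists_pos_le_dotProduct_sub hμ hi
    filter_upwards [Ioc_mem_nhdsGT hΔ₀] with Δ hΔ _ α hα θ hθ
    exact hΔ.2.trans (hgap α hα θ hθ)
  obtain ⟨Δ, hgap, hΔ⟩ := ((Filter.eventually_all.2 hsmall).and self_mem_nhdsWithin).exists
  exact ⟨Δ, hΔ, fun α hα θ hθ i hi => hgap i hi α hα θ hθ⟩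

end ModelEstimates

section PlayCounts

theorem playCount_succ_self {κ : Type*} [DecidableEq κ] (a : ℕ → κ) (n : ℕ) :
    playCount a (n + 1) (a n) = playCount a n (a n) + 1 :=
  Nat.count_succ_eq_succ_count (p := (a · = a n)) rfl

theorem card_le_card_mul_of_playCount_succ_le {κ : Type*} [Fintype κ] [DecidableEq κ]
    (a : ℕ → κ) (F : Finset ℕ) {X : ℝ} (hX : 0 ≤ X)
    (hF : ∀ n ∈ F, (playCount a (n + 1) (a n) : ℝ) ≤ X) :
    (F.card : ℝ) ≤ Fintype.card κ * X := by
  have hcard : F.card ≤ ((Finset.univ : Finset κ) ×ˢ Finset.range ⌊X⌋₊).card := by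
    refine Finset.card_le_card_of_injOn (fun n => (a n, playCount a n (a n))) (fun n hn => ?_)
      fun m _ n _ hmn => ?_
    · have hcount := Nat.le_floor (hF n hn)
      rw [playCount_succ_self] at hcount
      simpa using hcount
    · rw [Prod.mk.injEq] at hmn
      refine Nat.count_injective (p := (a · = a n)) hmn.1 rfl ?_
      have hcount := hmn.2
      rwa [hmn.1] at hcount
  rw [Finset.card_product, Finset.card_univ, Finset.card_range] at hcard
  calc (F.card : ℝ) ≤ Fintype.card κ * (⌊X⌋₊ : ℝ) := by exact_mod_cast hcard
    _ ≤ Fintype.card κ * X := by gcongr; exact Nat.floor_le hX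

theorem card_filter_le_of_monotone {f : ℕ → ℝ} (hf : Monotone f) (t : ℕ) (ht : 0 ≤ f t) :
    (((Finset.range t).filter fun s => ((s + 1 : ℕ) : ℝ) ≤ f (s + 1)).card : ℝ) ≤ f t := by
  have hsub : ((Finset.range t).filter fun s => ((s + 1 : ℕ) : ℝ) ≤ f (s + 1)) ⊆
      Finset.range ⌊f t⌋₊ := fun s hs => by
    rw [Finset.mem_filter, Finset.mem_range] at hs
    exact Finset.mem_range.2 (Nat.le_floor (hs.2.trans (hf hs.1)))
  calc _ ≤ (⌊f t⌋₊ : ℝ) := by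
        exact_mod_cast (Finset.card_le_card hsub).trans (Finset.card_range _).le
    _ ≤ f t := Nat.floor_le ht

variable {K d : ℕ} {μ : Fin K → ℝ} {k : Fin K} {a : ℕ → Fin K} {t : ℕ}

theorem suboptimalPlays_eq_card (k : Fin K) (a : ℕ → Fin K) (t : ℕ) :
    suboptimalPlays d k a t = ((Finset.range t).filter fun s => a (d + s) ≠ k).card := by
  rw [suboptimalPlays, Finset.sum_boole]

theorem suboptimalPlays_le (k : Fin K) (a : ℕ → Fin K) (t : ℕ) : suboptimalPlays d k a t ≤ t := by
  rw [suboptimalPlays_eq_card]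
  exact_mod_cast (Finset.card_filter_le _ _).trans (Finset.card_range t).le

theorem suboptimalPlays_le_card_add (Q : ℕ → Prop) [DecidablePred Q] {X : ℝ} (hX : 0 ≤ X)
    (hcount : ∀ s < t, ¬Q s → a (d + s) ≠ k →
      (playCount a (d + s + 1) (a (d + s)) : ℝ) ≤ X) :
    suboptimalPlays d k a t ≤ ((Finset.range t).filter Q).card + K * X := by
  set F : Finset ℕ := (Finset.range t).filter fun s => a (d + s) ≠ k ∧ ¬Q s with hF
  have hsplit : ((Finset.range t).filter fun s => a (d + s) ≠ k).card ≤
      ((Finset.range t).filter Q).card + F.card := by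
    refine (Finset.card_le_card fun s hs => ?_).trans (Finset.card_union_le _ _)
    rw [Finset.mem_filter] at hs
    rw [Finset.mem_union, hF, Finset.mem_filter, Finset.mem_filter]
    exact (em (Q s)).imp (⟨hs.1, ·⟩) (⟨hs.1, hs.2, ·⟩)
  have hcard : (F.card : ℝ) ≤ K * X := by
    have hmap := card_le_card_mul_of_playCount_succ_le a (F.map (addLeftEmbedding d)) hX
    rw [Finset.card_map, Fintype.card_fin] at hmap
    refine hmap fun n hn => ?_
    obtain ⟨s, hs, rfl⟩ := Finset.mem_map.1 hn
    rw [hF, Finset.mem_filter, Finset.mem_range] at hs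
    exact hcount s hs.1 hs.2.2 hs.2.1
  rw [suboptimalPlays_eq_card]
  calc _ ≤ (((Finset.range t).filter Q).card : ℝ) + F.card := by exact_mod_cast hsplit
    _ ≤ _ := by gcongr

theorem sub_le_maxGap (μ : Fin K → ℝ) (k i : Fin K) : μ k - μ i ≤ maxGap μ k :=
  le_ciSup (f := fun i => μ k - μ i) (Set.finite_range _).bddAbove i

theorem regret_le_maxGap_mul_suboptimalPlays (μ : Fin K → ℝ) (k : Fin K) (a : ℕ → Fin K) (t : ℕ) :
    regret d μ k a t ≤ maxGap μ k * suboptimalPlays d k a t := by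
  rw [regret, suboptimalPlays, Finset.mul_sum]
  refine Finset.sum_le_sum fun s _ => ?_
  split_ifs with h
  · rw [mul_one]
    exact sub_le_maxGap μ k _
  · rw [not_not.1 h, sub_self, mul_zero]

theorem regret_le_regretBound {R δ Δ : ℝ} (h : suboptimalPlays d k a t ≤ playBound d R δ Δ t) :
    regret d μ k a t ≤ regretBound d R δ (maxGap μ k) Δ t :=
  calc regret d μ k a t ≤ maxGap μ k * suboptimalPlays d k a t :=
        regret_le_maxGap_mul_suboptimalPlays μ k a t
    _ ≤ maxGap μ k * playBound d R δ Δ t :=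
        mul_le_mul_of_nonneg_left h ((sub_self (μ k)).ge.trans (sub_le_maxGap μ k k))
    _ = regretBound d R δ (maxGap μ k) Δ t := by
        rw [playBound, regretBound]
        ring

end PlayCounts

section Mistakes

variable {K d : ℕ} {hdK : d ≤ K} {Φ : Matrix (Fin K) (Fin d) ℝ} {μ : Fin K → ℝ} {k : Fin K}
  {a : ℕ → Fin K} {n : ℕ}

theorem lsEstimate_add (Φ : Matrix (Fin K) (Fin d) ℝ) (a : ℕ → Fin K) (y e : ℕ → ℝ) (n : ℕ) :
    lsEstimate Φ a (fun m => y m + e m) n =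
      lsEstimate Φ a y n + (designMatrix Φ a n)⁻¹ *ᵥ responseVector Φ a e n := by
  simp only [lsEstimate, responseVector, add_smul, Finset.sum_add_distrib, mulVec_add]

theorem lsEstimate_mean_eq (Φ : Matrix (Fin K) (Fin d) ℝ) (μ : Fin K → ℝ) (a : ℕ → Fin K)
    (n : ℕ) : lsEstimate Φ a (fun m => μ (a m)) n =
      (weightedGram Φ fun i => (playCount a n i : ℝ))⁻¹ *ᵥ
        ∑ i, ((playCount a n i : ℝ) * μ i) • Φ i := by
  rw [lsEstimate, designMatrix_eq_weightedGram, responseVector,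
    sum_range_comp_eq_sum_playCount_smul a n fun i => μ i • Φ i]
  simp only [mul_smul, Nat.cast_smul_eq_nsmul]

theorem IsModelGap.le_dotProduct_lsEstimate_mean {Δ : ℝ} (hΔ : IsModelGap Φ μ k Δ) (hn : 0 < n)
    (hV : (designMatrix Φ a n).PosDef) {i : Fin K} (hi : i ≠ k) :
    Δ ≤ Φ k ⬝ᵥ lsEstimate Φ a (fun m => μ (a m)) n
      - Φ i ⬝ᵥ lsEstimate Φ a (fun m => μ (a m)) n := by
  have hsum : ∑ i, (playCount a n i : ℝ) = n := by
    simpa using (sum_range_comp_eq_sum_playCount_smul a n fun _ => (1 : ℝ)).symm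
  rw [designMatrix_eq_weightedGram] at hV
  obtain ⟨α, hα, hest⟩ := exists_samplingDistribution_isModelEstimate
    (w := fun i => (playCount a n i : ℝ)) (fun i => Nat.cast_nonneg _)
    (by rw [hsum]; exact_mod_cast hn) hV.isUnit μ
  rw [lsEstimate_mean_eq]
  exact hΔ α hα _ hest i hi

theorem weightedNorm_inv_designMatrix_le_one (hbounded : ∀ i, ‖WithLp.toLp 2 (Φ i)‖ ≤ 1)
    (hforced : (forcedDesign hdK Φ - 1).PosSemidef)
    (ha : ∀ i : Fin d, a i = Fin.castLE hdK i) (hn : d ≤ n) (i : Fin K) :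
    weightedNorm (designMatrix Φ a n)⁻¹ (Φ i) ≤ 1 := by
  refine (sq_le_one_iff₀ (weightedNorm_nonneg _ _)).1 ?_
  rw [← one_mul (_ ^ 2)]
  refine mul_sq_weightedNorm_inv_le_one (designMatrix_posDef hforced ha hn) fun v => ?_
  rw [one_mul]
  exact (sq_dotProduct_le_of_norm_le_one (hbounded i) v).trans
    (dotProduct_self_le_sq_weightedNorm_designMatrix hforced ha hn v)

theorem playCount_mul_sq_weightedNorm_inv_le_one (hV : (designMatrix Φ a n).PosDef)
    (i : Fin K) : playCount a n i * weightedNorm (designMatrix Φ a n)⁻¹ (Φ i) ^ 2 ≤ 1 := by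
  refine mul_sq_weightedNorm_inv_le_one hV fun v => ?_
  rw [sq_weightedNorm_designMatrix]
  exact Finset.single_le_sum (f := fun i => (playCount a n i : ℝ) * (Φ i ⬝ᵥ v) ^ 2)
    (fun i _ => by positivity) (Finset.mem_univ i)

theorem FollowsOFUL.sub_le_mul_weightedNorm_inv (hd : 0 < d)
    (hbounded : ∀ i, ‖WithLp.toLp 2 (Φ i)‖ ≤ 1) (hforced : (forcedDesign hdK Φ - 1).PosSemidef)
    {Δ : ℝ} (hΔ : IsModelGap Φ μ k Δ) {R δ : ℝ} {e : ℕ → ℝ}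
    (ha : FollowsOFUL hdK Φ R δ a fun m => μ (a m) + e m) {s : ℕ} (hs : a (d + s) ≠ k) {r ε : ℝ}
    (hr : weightedNorm (designMatrix Φ a (d + s))⁻¹ (responseVector Φ a e (d + s)) ≤ r)
    (hε : 0 ≤ ε) (hrε : r ≤ √(confidenceRadiusSq d R δ (s + 1)) + ε) :
    Δ - ε ≤ (√(confidenceRadiusSq d R δ (s + 1)) + r) *
      weightedNorm (designMatrix Φ a (d + s))⁻¹ (Φ (a (d + s))) := by
  set ρ := √(confidenceRadiusSq d R δ (s + 1))
  have hdn : d ≤ d + s := Nat.le_add_right d s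
  have hV := designMatrix_posDef hforced ha.1 hdn
  obtain ⟨θ, hθ, hmax⟩ := ha.2 s
  have hgap := hΔ.le_dotProduct_lsEstimate_mean (Nat.add_pos_left hd s) hV hs
  have hopt := dotProduct_sub_le_of_optimistic hV (Real.sqrt_nonneg _)
    (θ₀ := lsEstimate Φ a (fun m => μ (a m)) (d + s)) (ρ := r) (by
      rwa [lsEstimate_add, add_sub_cancel_left, weightedNorm_inv_mulVec hV.isUnit])
    hθ fun θ' hθ' => hmax k θ' hθ'
  have hwidth : (r - ρ) * weightedNorm (designMatrix Φ a (d + s))⁻¹ (Φ k) ≤ ε :=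
    calc (r - ρ) * weightedNorm (designMatrix Φ a (d + s))⁻¹ (Φ k)
        ≤ ε * weightedNorm (designMatrix Φ a (d + s))⁻¹ (Φ k) :=
          mul_le_mul_of_nonneg_right (by linarith) (weightedNorm_nonneg _ _)
      _ ≤ ε := mul_le_of_le_one_right hε
          (weightedNorm_inv_designMatrix_le_one hbounded hforced ha.1 hdn k)
  linarith

theorem FollowsOFUL.playCount_succ_mul_sq_le (hd : 0 < d)
    (hbounded : ∀ i, ‖WithLp.toLp 2 (Φ i)‖ ≤ 1) (hforced : (forcedDesign hdK Φ - 1).PosSemidef)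
    {Δ : ℝ} (hΔ : IsModelGap Φ μ k Δ) {R δ : ℝ} {e : ℕ → ℝ}
    (ha : FollowsOFUL hdK Φ R δ a fun m => μ (a m) + e m) {s : ℕ} (hs : a (d + s) ≠ k) {r ε : ℝ}
    (hr : weightedNorm (designMatrix Φ a (d + s))⁻¹ (responseVector Φ a e (d + s)) ≤ r)
    (hε : 0 ≤ ε) (hεΔ : ε ≤ Δ) (hrε : r ≤ √(confidenceRadiusSq d R δ (s + 1)) + ε) :
    playCount a (d + s + 1) (a (d + s)) * (Δ - ε) ^ 2 ≤
      2 * (√(confidenceRadiusSq d R δ (s + 1)) + r) ^ 2 := by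
  set ρ := √(confidenceRadiusSq d R δ (s + 1))
  set n := d + s
  set w := weightedNorm (designMatrix Φ a n)⁻¹ (Φ (a n))
  have hdn : d ≤ n := Nat.le_add_right d s
  have hkey : Δ - ε ≤ (ρ + r) * w :=
    ha.sub_le_mul_weightedNorm_inv hd hbounded hforced hΔ hs hr hε hrε
  have hcount : playCount a n (a n) * w ^ 2 ≤ 1 :=
    playCount_mul_sq_weightedNorm_inv_le_one (designMatrix_posDef hforced ha.1 hdn) _
  have hone : w ^ 2 ≤ 1 := (sq_le_one_iff₀ (weightedNorm_nonneg _ _)).2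
    (weightedNorm_inv_designMatrix_le_one hbounded hforced ha.1 hdn _)
  calc (playCount a (n + 1) (a n) : ℝ) * (Δ - ε) ^ 2
      ≤ (playCount a n (a n) + 1) * ((ρ + r) * w) ^ 2 := by
        rw [playCount_succ_self, Nat.cast_succ]
        gcongr
    _ = (playCount a n (a n) * w ^ 2 + w ^ 2) * (ρ + r) ^ 2 := by ring
    _ ≤ 2 * (ρ + r) ^ 2 := by gcongr; linarith

end Mistakes

section LogTerm

variable {d : ℕ} {R δ : ℝ} {t : ℕ}

theorem monotone_mul_log_one_add_div (d : ℕ) :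
    Monotone fun t : ℕ => d * Real.log (1 + (t : ℝ) / d) := fun t u htu => by
  have hcast : (t : ℝ) ≤ u := by exact_mod_cast htu
  have hlog : Real.log (1 + (t : ℝ) / d) ≤ Real.log (1 + (u : ℝ) / d) :=
    Real.log_le_log (by positivity) (by gcongr)
  exact mul_le_mul_of_nonneg_left hlog d.cast_nonneg

theorem two_mul_logTerm (hd : 0 < d) (hδ : 0 < δ) (t : ℕ) :
    2 * logTerm d δ t = 2 * -Real.log δ + d * Real.log (1 + t / d) := by
  have hbase : (0 : ℝ) < 1 + t / d := by positivity
  rw [logTerm, Real.log_div (by positivity) hδ.ne', Real.log_rpow hbase]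
  ring

theorem monotone_logTerm (hd : 0 < d) (hδ : 0 < δ) : Monotone (logTerm d δ) := fun t u htu => by
  have hlog := monotone_mul_log_one_add_div d htu
  simp only at hlog
  linarith [two_mul_logTerm hd hδ t, two_mul_logTerm hd hδ u]

theorem half_le_mul_log_one_add_natCast_div (hd : 0 < d) (ht : 1 ≤ t) :
    1 / 2 ≤ d * Real.log (1 + (t : ℝ) / d) :=
  half_le_mul_log_one_add_div (by exact_mod_cast hd) (by exact_mod_cast ht)

theorem one_add_neg_log_le_mul_logTerm (hd : 0 < d) (hδ : 0 < δ) (hδ1 : δ < 1) (ht : 1 ≤ t) :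
    1 + -Real.log δ ≤ 4 * logTerm d δ t := by
  linarith [two_mul_logTerm hd hδ t, half_le_mul_log_one_add_natCast_div hd ht,
    Real.log_neg hδ hδ1]

theorem quarter_le_logTerm (hd : 0 < d) (hδ : 0 < δ) (hδ1 : δ < 1) (ht : 1 ≤ t) :
    1 / 4 ≤ logTerm d δ t := by
  linarith [one_add_neg_log_le_mul_logTerm hd hδ hδ1 ht, Real.log_neg hδ hδ1]

theorem sqrt_confidenceRadiusSq (d : ℕ) (hR : 0 ≤ R) (δ : ℝ) (t : ℕ) :
    √(confidenceRadiusSq d R δ t) = R * √(2 * logTerm d δ t) := by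
  rw [confidenceRadiusSq, mul_right_comm, mul_comm, Real.sqrt_mul (sq_nonneg R), Real.sqrt_sq hR]

/-- The factor `√t R √(log ((1 + t/d)^(d/2) / δ)) √(log ((1 + t/d)^d))` which `playBound`
multiplies by `4 / Δ`. -/
noncomputable def playScale (d : ℕ) (R δ : ℝ) (t : ℕ) : ℝ :=
  √t * R * √(logTerm d δ t) * √(d * Real.log (1 + t / d))

theorem playBound_eq_mul_playScale (d : ℕ) (R δ Δ : ℝ) (t : ℕ) :
    playBound d R δ Δ t = 4 / Δ * playScale d R δ t := by
  rw [playBound, playScale, Real.log_pow]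
  ring

theorem playScale_nonneg (d : ℕ) (hR : 0 ≤ R) (δ : ℝ) (t : ℕ) : 0 ≤ playScale d R δ t := by
  rw [playScale]
  positivity

theorem monotone_playScale (hd : 0 < d) (hR : 0 ≤ R) (hδ : 0 < δ) :
    Monotone (playScale d R δ) := fun t u htu => by
  have hlogTerm := monotone_logTerm hd hδ htu
  have hlog := monotone_mul_log_one_add_div d htu
  simp only at hlog
  rw [playScale, playScale]
  gcongr

theorem sq_mul_logTerm_le_of_mul_playScale_lt (hd : 0 < d) (hR : 0 ≤ R) (hδ : 0 < δ)
    (hδ1 : δ < 1) {C : ℝ} (hC : 0 ≤ C) (ht : 1 ≤ t) (hscale : C * playScale d R δ t < t) :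
    C ^ 2 * (R ^ 2 * logTerm d δ t) ≤ 2 * (C * playScale d R δ t) := by
  have hD := half_le_mul_log_one_add_natCast_div hd ht
  have hL := quarter_le_logTerm hd hδ hδ1 ht
  set L := logTerm d δ t
  set D := d * Real.log (1 + (t : ℝ) / d)
  set y := C * R * √L * √D with hy
  have hCy : C * playScale d R δ t = √t * y := by rw [playScale]; ring
  have hyt : y ≤ √t := by
    rw [hCy] at hscale
    nth_rw 2 [← Real.mul_self_sqrt t.cast_nonneg] at hscale
    exact (lt_of_mul_lt_mul_left hscale (Real.sqrt_nonneg _)).le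
  calc C ^ 2 * (R ^ 2 * L) = 2 * (C ^ 2 * (R ^ 2 * L) * (1 / 2)) := by ring
    _ ≤ 2 * (C ^ 2 * (R ^ 2 * L) * D) := by gcongr
    _ = 2 * (y * y) := by
      rw [hy, ← sq, mul_pow, mul_pow, mul_pow, Real.sq_sqrt (by linarith),
        Real.sq_sqrt (by linarith)]
      ring
    _ ≤ 2 * (√t * y) := by gcongr
    _ = 2 * (C * playScale d R δ t) := by rw [hCy]

end LogTerm

section RadiusExcess

theorem sqrt_add_le_add_div {u g : ℝ} (hu : 0 < u) (hg : 0 ≤ g) : √(u + g) ≤ √u + g / √u := by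
  rw [Real.sqrt_le_left (by positivity)]
  calc u + g ≤ √u ^ 2 + 2 * g + (g / √u) ^ 2 := by
        rw [Real.sq_sqrt hu.le]
        linarith [sq_nonneg (g / √u)]
    _ = (√u + g / √u) ^ 2 := by field_simp; ring

theorem mul_sqrt_add_le {R u g ε : ℝ} (hR : 0 ≤ R) (hu : 0 < u) (hg : 0 ≤ g) (hε : 0 ≤ ε)
    (h : (R * g) ^ 2 ≤ ε ^ 2 * u) : R * √(u + g) ≤ R * √u + ε := by
  have hexcess : R * g ≤ ε * √u := by
    refine (sq_le_sq₀ (by positivity) (by positivity)).1 ?_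
    rwa [mul_pow ε, Real.sq_sqrt hu.le]
  calc R * √(u + g) ≤ R * (√u + g / √u) := by gcongr; exact sqrt_add_le_add_div hu hg
    _ = R * √u + R * g / √u := by ring
    _ ≤ R * √u + ε := by gcongr; rwa [div_le_iff₀ (by positivity)]

theorem sq_mul_le_of_early {R L G x t C C₁ C₂ Δ : ℝ} (hL : 0 < L) (hx : 0 ≤ x) (hxL : x ≤ 4 * L)
    (hC : 0 < C) (hC₁ : 0 ≤ C₁) (hC₂ : 0 ≤ C₂) (hCC : 64 * C₁ * C₂ = (C * Δ) ^ 2)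
    (hRL : C ^ 2 * (R ^ 2 * L) ≤ 2 * t) (ht : t < C₁ * (x * √x)) (hG : G ^ 2 ≤ C₂ * √x) :
    (R * G) ^ 2 ≤ (Δ / 2) ^ 2 * (2 * L) := by
  refine le_of_mul_le_mul_left ?_ (show 0 < C ^ 2 * L by positivity)
  calc C ^ 2 * L * (R * G) ^ 2 = C ^ 2 * (R ^ 2 * L) * G ^ 2 := by ring
    _ ≤ 2 * (C₁ * (x * √x)) * (C₂ * √x) := by
      gcongr ?_ * ?_
      linarith
    _ = 2 * C₁ * C₂ * x * √x ^ 2 := by ring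
    _ = 2 * C₁ * C₂ * x * x := by rw [Real.sq_sqrt hx]
    _ ≤ 2 * C₁ * C₂ * (4 * L) * (4 * L) := by gcongr
    _ = 64 * C₁ * C₂ * L ^ 2 / 2 := by ring
    _ = C ^ 2 * L * ((Δ / 2) ^ 2 * (2 * L)) := by rw [hCC]; ring

variable {K d : ℕ} {R δ C C₀ C₁ C₂ Δ : ℝ} {n t : ℕ}

theorem RadiusConstants.le_mul_logTerm (hc : RadiusConstants K d C₀ C₁ C₂) (hd : 0 < d)
    (hδ : 0 < δ) (hδ1 : δ < 1) (ht : 1 ≤ t) (hn : n ≤ d + t) :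
    selfNormalizedRadiusSq K d (-Real.log δ) (Nat.log 2 n) ≤ C₀ * (2 * logTerm d δ t) := by
  rw [two_mul_logTerm hd hδ]
  exact hc.le_mul (neg_nonneg.2 (Real.log_neg hδ hδ1).le) ht hn

theorem RadiusConstants.le_logTerm_of_late (hc : RadiusConstants K d C₀ C₁ C₂) (hd : 0 < d)
    (hδ : 0 < δ) (hδ1 : δ < 1) (ht : 1 ≤ t) (hn : n ≤ d + t)
    (hlate : C₁ * ((1 + -Real.log δ) * √(1 + -Real.log δ)) ≤ t) :
    selfNormalizedRadiusSq K d (-Real.log δ) (Nat.log 2 n) ≤ 2 * logTerm d δ t := by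
  rw [two_mul_logTerm hd hδ]
  exact hc.le_of_late (neg_nonneg.2 (Real.log_neg hδ hδ1).le) ht hn hlate

theorem RadiusConstants.mul_sqrt_le_add_of_mul_playScale_lt (hc : RadiusConstants K d C₀ C₁ C₂)
    (hd : 0 < d) (hR : 0 ≤ R) (hδ : 0 < δ) (hδ1 : δ < 1) (hC : 0 < C) (hΔ : 0 ≤ Δ)
    (hCC : 64 * C₁ * C₂ = (C * Δ) ^ 2) (ht : 1 ≤ t) (hn : n ≤ d + t)
    (hscale : C * playScale d R δ t < t) :
    R * √(selfNormalizedRadiusSq K d (-Real.log δ) (Nat.log 2 n)) ≤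
      R * √(2 * logTerm d δ t) + Δ / 2 := by
  have hℓ : 0 ≤ -Real.log δ := neg_nonneg.2 (Real.log_neg hδ hδ1).le
  rcases le_or_gt (C₁ * ((1 + -Real.log δ) * √(1 + -Real.log δ))) t with hlate | hearly
  · have hW := hc.le_logTerm_of_late hd hδ hδ1 ht hn hlate
    have hRW : R * √(selfNormalizedRadiusSq K d (-Real.log δ) (Nat.log 2 n)) ≤
      R * √(2 * logTerm d δ t) := by gcongr
    linarith
  · set W := selfNormalizedRadiusSq K d (-Real.log δ) (Nat.log 2 n)
    have hL := quarter_le_logTerm hd hδ hδ1 ht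
    have hRL := sq_mul_logTerm_le_of_mul_playScale_lt hd hR hδ hδ1 hC.le ht hscale
    have hℓW : 2 * -Real.log δ ≤ W := two_mul_le_selfNormalizedRadiusSq K d _ _
    have hWL : W ≤ 2 * logTerm d δ t + (W - 2 * -Real.log δ) := by
      linarith [two_mul_logTerm hd hδ t, half_le_mul_log_one_add_natCast_div hd ht]
    calc R * √W ≤ R * √(2 * logTerm d δ t + (W - 2 * -Real.log δ)) := by gcongr
      _ ≤ R * √(2 * logTerm d δ t) + Δ / 2 :=
        mul_sqrt_add_le hR (by linarith) (sub_nonneg.2 hℓW) (by linarith)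
          (sq_mul_le_of_early (by linarith) (by linarith)
            (one_add_neg_log_le_mul_logTerm hd hδ hδ1 ht) hC hc.pos₁.le hc.pos₂.le hCC
            (by linarith) hearly (hc.sq_sub_le_of_early hℓ ht hn hearly))

end RadiusExcess

section PathwiseBounds

variable {K d : ℕ} {hdK : d ≤ K} {Φ : Matrix (Fin K) (Fin d) ℝ} {μ : Fin K → ℝ} {k : Fin K}
  {R δ Δ C C₀ C₁ C₂ : ℝ} {a : ℕ → Fin K} {e : ℕ → ℝ} {s t : ℕ}

theorem FollowsOFUL.playCount_succ_le (hd : 0 < d) (hbounded : ∀ i, ‖WithLp.toLp 2 (Φ i)‖ ≤ 1)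
    (hforced : (forcedDesign hdK Φ - 1).PosSemidef) (hΔ : IsModelGap Φ μ k Δ)
    (hR : 0 ≤ R) (hδ : 0 < δ) (hδ1 : δ < 1)
    (ha : FollowsOFUL hdK Φ R δ a fun m => μ (a m) + e m)
    (he : NoiseControlled Φ R (-Real.log δ) a e) (hs : a (d + s) ≠ k) {ε : ℝ} (hε : 0 ≤ ε)
    (hεΔ : ε < Δ) (hC : 1 ≤ C)
    (hW : selfNormalizedRadiusSq K d (-Real.log δ) (Nat.log 2 (d + s)) ≤
      C * (2 * logTerm d δ (s + 1)))
    (hRW : R * √(selfNormalizedRadiusSq K d (-Real.log δ) (Nat.log 2 (d + s))) ≤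
      R * √(2 * logTerm d δ (s + 1)) + ε) (hst : s < t) :
    (playCount a (d + s + 1) (a (d + s)) : ℝ) ≤ 16 * C * R ^ 2 * logTerm d δ t / (Δ - ε) ^ 2 := by
  rw [le_div_iff₀ (pow_pos (sub_pos.2 hεΔ) 2)]
  have hL := quarter_le_logTerm hd hδ hδ1 (Nat.le_add_left 1 s)
  have hmono : logTerm d δ (s + 1) ≤ logTerm d δ t := monotone_logTerm hd hδ hst
  set L := logTerm d δ (s + 1) with hLdef
  have hCL : 2 * L ≤ C * (2 * L) := le_mul_of_one_le_left (by linarith) hC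
  have hcount := ha.playCount_succ_mul_sq_le hd hbounded hforced hΔ hs
    (he (d + s) (Nat.le_add_right d s)) hε hεΔ.le (by rwa [sqrt_confidenceRadiusSq d hR])
  rw [sqrt_confidenceRadiusSq d hR, ← hLdef] at hcount
  calc _ ≤ _ := hcount
    _ ≤ 2 * (R * √(C * (2 * L)) + R * √(C * (2 * L))) ^ 2 := by gcongr
    _ = 8 * R ^ 2 * √(C * (2 * L)) ^ 2 := by ring
    _ = 16 * C * R ^ 2 * L := by rw [Real.sq_sqrt (by positivity)]; ring
    _ ≤ 16 * C * R ^ 2 * logTerm d δ t := by gcongr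

theorem FollowsOFUL.suboptimalPlays_le_mul_playScale_add (hc : RadiusConstants K d C₀ C₁ C₂)
    (hd : 0 < d) (hbounded : ∀ i, ‖WithLp.toLp 2 (Φ i)‖ ≤ 1)
    (hforced : (forcedDesign hdK Φ - 1).PosSemidef) (hΔ0 : 0 < Δ) (hΔ : IsModelGap Φ μ k Δ)
    (hC : 0 < C) (hCC : 64 * C₁ * C₂ = (C * Δ) ^ 2) (hR : 0 ≤ R) (hδ : 0 < δ) (hδ1 : δ < 1)
    (ha : FollowsOFUL hdK Φ R δ a fun m => μ (a m) + e m)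
    (he : NoiseControlled Φ R (-Real.log δ) a e) (ht : 1 ≤ t) :
    suboptimalPlays d k a t ≤
      C * playScale d R δ t + K * (16 * C₀ * R ^ 2 * logTerm d δ t / (Δ - Δ / 2) ^ 2) := by
  classical
  have hL := quarter_le_logTerm hd hδ hδ1 ht
  have hC₀ := hc.one_le
  have hcard := card_filter_le_of_monotone ((monotone_playScale hd hR hδ).const_mul hC.le) t
    (mul_nonneg hC.le (playScale_nonneg d hR δ t))
  refine (suboptimalPlays_le_card_add
    (fun s => ((s + 1 : ℕ) : ℝ) ≤ C * playScale d R δ (s + 1)) (by positivity)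
    fun s hst hscale hs => ?_).trans (add_le_add_left hcard _)
  have hs1 : 1 ≤ s + 1 := Nat.le_add_left 1 s
  have hn : d + s ≤ d + (s + 1) := by lia
  exact ha.playCount_succ_le hd hbounded hforced hΔ hR hδ hδ1 he hs (by positivity)
    (half_lt_self hΔ0) hC₀ (hc.le_mul_logTerm hd hδ hδ1 hs1 hn)
    (hc.mul_sqrt_le_add_of_mul_playScale_lt hd hR hδ hδ1 hC hΔ0.le hCC hs1 hn (not_le.1 hscale)) hst

theorem FollowsOFUL.suboptimalPlays_le_mul_playScale (hc : RadiusConstants K d C₀ C₁ C₂)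
    (hd : 0 < d) (hbounded : ∀ i, ‖WithLp.toLp 2 (Φ i)‖ ≤ 1)
    (hforced : (forcedDesign hdK Φ - 1).PosSemidef) (hΔ0 : 0 < Δ) (hΔ : IsModelGap Φ μ k Δ)
    (hC : 0 < C) (hCC : 64 * C₁ * C₂ = (C * Δ) ^ 2) (hR : 0 ≤ R) (hδ : 0 < δ) (hδ1 : δ < 1)
    (ha : FollowsOFUL hdK Φ R δ a fun m => μ (a m) + e m)
    (he : NoiseControlled Φ R (-Real.log δ) a e) (t : ℕ) :
    suboptimalPlays d k a t ≤ (1 + 2 * K * C₀ / (C₁ * C₂)) * (C * playScale d R δ t) := by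
  have hC₀ := hc.one_le
  have hC₁ := hc.pos₁
  have hC₂ := hc.pos₂
  have hB := mul_nonneg hC.le (playScale_nonneg d hR δ t)
  rcases le_or_gt (t : ℝ) (C * playScale d R δ t) with htriv | hscale
  · have hF : 0 ≤ 2 * K * C₀ / (C₁ * C₂) := by positivity
    exact (suboptimalPlays_le k a t).trans
      (htriv.trans (le_mul_of_one_le_left hB (le_add_of_nonneg_right hF)))
  have ht : 1 ≤ t := by exact_mod_cast hB.trans_lt hscale
  have hX : 16 * C₀ * R ^ 2 * logTerm d δ t / (Δ - Δ / 2) ^ 2 =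
      C₀ / (C₁ * C₂) * (C ^ 2 * (R ^ 2 * logTerm d δ t)) :=
    calc _ = 64 * C₀ / (C * Δ) ^ 2 * (C ^ 2 * (R ^ 2 * logTerm d δ t)) := by field_simp; ring
      _ = _ := by rw [← hCC]; field_simp
  calc suboptimalPlays d k a t
      ≤ C * playScale d R δ t + K * (16 * C₀ * R ^ 2 * logTerm d δ t / (Δ - Δ / 2) ^ 2) :=
        ha.suboptimalPlays_le_mul_playScale_add hc hd hbounded hforced hΔ0 hΔ hC hCC hR hδ hδ1 he
          ht
    _ = C * playScale d R δ t + K * (C₀ / (C₁ * C₂) * (C ^ 2 * (R ^ 2 * logTerm d δ t))) := by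
        rw [hX]
    _ ≤ C * playScale d R δ t + K * (C₀ / (C₁ * C₂) * (2 * (C * playScale d R δ t))) := by
        gcongr _ + _ * (_ * ?_)
        exact sq_mul_logTerm_le_of_mul_playScale_lt hd hR hδ hδ1 hC.le ht hscale
    _ = (1 + 2 * K * C₀ / (C₁ * C₂)) * (C * playScale d R δ t) := by ring

theorem IsModelGap.exists_forall_suboptimalPlays_le (hΔ : IsModelGap Φ μ k Δ) (hΔ0 : 0 < Δ)
    (hd : 0 < d) (hbounded : ∀ i, ‖WithLp.toLp 2 (Φ i)‖ ≤ 1)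
    (hforced : (forcedDesign hdK Φ - 1).PosSemidef) :
    ∃ Δmin, 0 < Δmin ∧ IsModelGap Φ μ k Δmin ∧ ∀ R δ : ℝ, 0 ≤ R → 0 < δ → δ < 1 → ∀ a e,
      FollowsOFUL hdK Φ R δ a (fun m => μ (a m) + e m) →
        NoiseControlled Φ R (-Real.log δ) a e →
          ∀ t, suboptimalPlays d k a t ≤ playBound d R δ Δmin t := by
  obtain ⟨C₀, C₁, C₂, hc⟩ := exists_radiusConstants K hd
  have hC₀ := hc.one_le
  have hC₁ := hc.pos₁
  have hC₂ := hc.pos₂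
  set C := 8 * √(C₁ * C₂) / Δ with hCdef
  have hC : 0 < C := by positivity
  have hCC : 64 * C₁ * C₂ = (C * Δ) ^ 2 := by
    rw [hCdef, div_mul_cancel₀ _ hΔ0.ne', mul_pow, Real.sq_sqrt (by positivity)]
    ring
  set F := (1 + 2 * K * C₀ / (C₁ * C₂)) * C with hF
  have hF0 : 0 < F := by positivity
  have hmin : 0 < min Δ (4 / F) := lt_min hΔ0 (by positivity)
  refine ⟨min Δ (4 / F), hmin, fun α hα θ hθ i hi => (min_le_left _ _).trans (hΔ α hα θ hθ i hi),
    fun R δ hR hδ hδ1 a e ha he t => ?_⟩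
  have hF4 : F ≤ 4 / min Δ (4 / F) := by
    rw [le_div_iff₀ hmin, ← le_div_iff₀' hF0]
    exact min_le_right _ _
  calc suboptimalPlays d k a t ≤ F * playScale d R δ t := by
        rw [hF, mul_assoc]
        exact ha.suboptimalPlays_le_mul_playScale hc hd hbounded hforced hΔ0 hΔ hC hCC hR hδ hδ1
          he t
    _ ≤ 4 / min Δ (4 / F) * playScale d R δ t :=
        mul_le_mul_of_nonneg_right hF4 (playScale_nonneg d hR δ t)
    _ = playBound d R δ (min Δ (4 / F)) t := (playBound_eq_mul_playScale d R δ _ t).symm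

theorem FollowsOFUL.suboptimalPlays_le_ceil_add (hc : RadiusConstants K d C₀ C₁ C₂)
    (hd : 0 < d) (hbounded : ∀ i, ‖WithLp.toLp 2 (Φ i)‖ ≤ 1)
    (hforced : (forcedDesign hdK Φ - 1).PosSemidef) (hΔ0 : 0 < Δ) (hΔ : IsModelGap Φ μ k Δ)
    (hR : 0 ≤ R) (hδ : 0 < δ) (hδ1 : δ < 1)
    (ha : FollowsOFUL hdK Φ R δ a fun m => μ (a m) + e m)
    (he : NoiseControlled Φ R (-Real.log δ) a e) (ht : 1 ≤ t) :
    suboptimalPlays d k a t ≤ ⌈C₁ * ((1 + -Real.log δ) * √(1 + -Real.log δ))⌉₊ +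
      K * (16 * R ^ 2 * logTerm d δ t / Δ ^ 2) := by
  set T := ⌈C₁ * ((1 + -Real.log δ) * √(1 + -Real.log δ))⌉₊
  have hL := quarter_le_logTerm hd hδ hδ1 ht
  have hcard : (((Finset.range t).filter (· < T)).card : ℝ) ≤ T := by
    have hsub : (Finset.range t).filter (· < T) ⊆ Finset.range T := fun s hs =>
      Finset.mem_range.2 (Finset.mem_filter.1 hs).2
    exact_mod_cast (Finset.card_le_card hsub).trans (Finset.card_range T).le
  refine (suboptimalPlays_le_card_add (· < T) (by positivity)
    fun s hst hsT hs => ?_).trans (add_le_add_left hcard _)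
  have hlate : C₁ * ((1 + -Real.log δ) * √(1 + -Real.log δ)) ≤ (s + 1 : ℕ) :=
    (Nat.le_ceil _).trans (by exact_mod_cast (not_lt.1 hsT).trans (Nat.le_succ s))
  have hW := hc.le_logTerm_of_late hd hδ hδ1 (Nat.le_add_left 1 s)
    (show d + s ≤ d + (s + 1) by lia) hlate
  have hcount := ha.playCount_succ_le hd hbounded hforced hΔ hR hδ hδ1 he hs le_rfl hΔ0 le_rfl
    (by rwa [one_mul]) (by rw [add_zero]; gcongr) hst
  rwa [mul_one, sub_zero] at hcount

theorem eventually_logTerm_le_mul (hd : 0 < d) (hδ : 0 < δ) {q : ℝ} (hq : 0 < q) :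
    ∀ᶠ t : ℕ in Filter.atTop, logTerm d δ t ≤ q * t := by
  filter_upwards [tendsto_natCast_atTop_atTop.eventually_ge_atTop
    ((-Real.log δ + d / 2 * (q - 1 - Real.log q)) / (q / 2))] with t ht
  rw [div_le_iff₀ (by positivity)] at ht
  have hlog := mul_le_mul_of_nonneg_left
    (log_le_mul_sub_one_sub_log hq (show 0 < 1 + (t : ℝ) / d by positivity)) d.cast_nonneg
  have hsplit : d * (q * (1 + (t : ℝ) / d) - 1 - Real.log q) =
      d * (q - 1 - Real.log q) + q * t := by
    field_simp
    ring
  linarith [two_mul_logTerm hd hδ t]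

theorem eventually_add_mul_logTerm_le (hd : 0 < d) (hδ : 0 < δ) (hδ1 : δ < 1) {T c c' : ℝ}
    (hT : 0 ≤ T) (hc : 0 < c) (hc' : 0 < c') :
    ∀ᶠ t : ℕ in Filter.atTop, T + c * logTerm d δ t ≤ c' * (√t * √(logTerm d δ t)) := by
  filter_upwards [eventually_logTerm_le_mul hd hδ (show 0 < (c' / (2 * c)) ^ 2 by positivity),
    tendsto_natCast_atTop_atTop.eventually_ge_atTop ((4 * T / c') ^ 2),
    Filter.eventually_ge_atTop 1] with t hLt hTt ht
  have hL := quarter_le_logTerm hd hδ hδ1 ht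
  set L := logTerm d δ t
  have hhalf : 1 / 2 ≤ √L := Real.le_sqrt_of_sq_le (by linarith)
  have hsqrt : √L ≤ c' / (2 * c) * √t := by
    rw [← Real.sqrt_sq (show 0 ≤ c' / (2 * c) by positivity), ← Real.sqrt_mul (sq_nonneg _)]
    exact Real.sqrt_le_sqrt hLt
  have hTsqrt : 2 * T ≤ c' / 2 * √t := by
    have hdiv : 4 * T / c' ≤ √t := Real.le_sqrt_of_sq_le hTt
    rw [div_le_iff₀ hc'] at hdiv
    linarith
  calc T + c * L = 2 * T * (1 / 2) + c * √L ^ 2 := by rw [Real.sq_sqrt (by linarith)]; ring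
    _ ≤ 2 * T * √L + c * √L ^ 2 := by gcongr
    _ = (2 * T + c * √L) * √L := by ring
    _ ≤ (c' / 2 * √t + c * (c' / (2 * c) * √t)) * √L := by gcongr
    _ = c' * (√t * √L) := by field_simp; ring

theorem div_mul_sqrt_le_playBound (hd : 0 < d) (hR : 0 ≤ R) (hΔ0 : 0 ≤ Δ) (ht : 1 ≤ t) :
    2 * R / Δ * (√t * √(logTerm d δ t)) ≤ playBound d R δ Δ t := by
  have hD : 1 / 2 ≤ √(d * Real.log (1 + (t : ℝ) / d)) :=
    Real.le_sqrt_of_sq_le (by linarith [half_le_mul_log_one_add_natCast_div hd ht])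
  rw [playBound_eq_mul_playScale, playScale]
  calc 2 * R / Δ * (√t * √(logTerm d δ t))
      = 4 / Δ * (√t * R * √(logTerm d δ t) * (1 / 2)) := by ring
    _ ≤ _ := by gcongr

theorem IsModelGap.exists_time_forall_suboptimalPlays_le (hΔ : IsModelGap Φ μ k Δ) (hΔ0 : 0 < Δ)
    (hd : 0 < d) (hbounded : ∀ i, ‖WithLp.toLp 2 (Φ i)‖ ≤ 1)
    (hforced : (forcedDesign hdK Φ - 1).PosSemidef) (hR : 0 < R) (hδ : 0 < δ) :
    ∃ T₀ : ℕ, δ < 1 → ∀ a e, FollowsOFUL hdK Φ R δ a (fun m => μ (a m) + e m) →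
      NoiseControlled Φ R (-Real.log δ) a e →
        ∀ t, T₀ ≤ t → suboptimalPlays d k a t ≤ playBound d R δ Δ t := by
  rcases le_or_gt 1 δ with hδ1 | hδ1
  · exact ⟨0, fun h => absurd h hδ1.not_gt⟩
  obtain ⟨C₀, C₁, C₂, hc⟩ := exists_radiusConstants K hd
  set T := ⌈C₁ * ((1 + -Real.log δ) * √(1 + -Real.log δ))⌉₊
  have hlate := (eventually_add_mul_logTerm_le hd hδ hδ1 T.cast_nonneg
    (show 0 < 16 * (K + 1) * R ^ 2 / Δ ^ 2 by positivity)
    (show 0 < 2 * R / Δ by positivity)).and (Filter.eventually_ge_atTop 1)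
  obtain ⟨T₀, hT₀⟩ := Filter.eventually_atTop.1 hlate
  refine ⟨T₀, fun _ a e ha he t ht => ?_⟩
  obtain ⟨hbound, ht1⟩ := hT₀ t ht
  have hL := quarter_le_logTerm hd hδ hδ1 ht1
  calc suboptimalPlays d k a t
      ≤ T + K * (16 * R ^ 2 * logTerm d δ t / Δ ^ 2) :=
        ha.suboptimalPlays_le_ceil_add hc hd hbounded hforced hΔ0 hΔ hR.le hδ hδ1 he ht1
    _ = T + 16 * K * R ^ 2 / Δ ^ 2 * logTerm d δ t := by ring
    _ ≤ T + 16 * (K + 1) * R ^ 2 / Δ ^ 2 * logTerm d δ t := by gcongr; linarith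
    _ ≤ 2 * R / Δ * (√t * √(logTerm d δ t)) := hbound
    _ ≤ playBound d R δ Δ t := div_mul_sqrt_le_playBound hd hR.le hΔ0.le ht1

end PathwiseBounds

end MisspecifiedBandit

open MisspecifiedBandit in
theorem mainTheorem3 {K d : ℕ} (hd : 0 < d) (hdK : d < K)
    (Φ : Matrix (Fin K) (Fin d) ℝ)
    (hbounded : ∀ i, ‖WithLp.toLp 2 (Φ i)‖ ≤ 1)
    -- the least eigenvalue of the forced-exploration design is at least `1`
    (hforced : (forcedDesign hdK.le Φ - 1).PosSemidef)
    (μ : Fin K → ℝ) (k : Fin K)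
    (hμ : μ ∈ interior (robustObservationRegion Φ k)) :
    -- the explicit bound, at all times, with a positive model-space gap `Δmin`
    -- that depends on `Φ` and `μ` only
    (∃ Δmin : ℝ, 0 < Δmin ∧ IsModelGap Φ μ k Δmin ∧
      ∀ R : ℝ, 0 < R → ∀ δ : ℝ, 0 < δ →
        ∀ (Ω : Type*) [MeasurableSpace Ω] (P : MeasureTheory.Measure Ω)
          [MeasureTheory.IsProbabilityMeasure P] (A : ℕ → Ω → Fin K) (η : ℕ → Ω → ℝ),
          IsOFULRun hdK.le Φ μ R δ P A η →
          1 - δ ≤ P.real {ω | ∀ t : ℕ,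
            suboptimalPlays d k (fun n => A n ω) t ≤ playBound d R δ Δmin t ∧
            regret d μ k (fun n => A n ω) t ≤ regretBound d R δ (maxGap μ k) Δmin t}) ∧
    -- the same bound with an arbitrary model-space gap, for all large times
    (∀ Δ : ℝ, 0 < Δ → IsModelGap Φ μ k Δ →
      ∀ R : ℝ, 0 < R → ∀ δ : ℝ, 0 < δ → ∃ T₀ : ℕ,
        ∀ (Ω : Type*) [MeasurableSpace Ω] (P : MeasureTheory.Measure Ω)
          [MeasureTheory.IsProbabilityMeasure P] (A : ℕ → Ω → Fin K) (η : ℕ → Ω → ℝ),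
          IsOFULRun hdK.le Φ μ R δ P A η →
          1 - δ ≤ P.real {ω | ∀ t : ℕ, T₀ ≤ t →
            suboptimalPlays d k (fun n => A n ω) t ≤ playBound d R δ Δ t ∧
            regret d μ k (fun n => A n ω) t ≤ regretBound d R δ (maxGap μ k) Δ t}) := by
  constructor
  · obtain ⟨Δ, hΔ0, hΔ⟩ := exists_isModelGap hμ
    obtain ⟨Δmin, hΔmin0, hΔmin, hplays⟩ :=
      hΔ.exists_forall_suboptimalPlays_le hΔ0 hd hbounded hforced
    refine ⟨Δmin, hΔmin0, hΔmin, fun R hR δ hδ Ω _ P _ A η hrun => ?_⟩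
    refine hrun.one_sub_le_measureReal hforced hR hδ fun ω hδ1 hnoise t => ?_
    have hplay := hplays R δ hR.le hδ hδ1 _ _ (hrun.follows ω) hnoise t
    exact ⟨hplay, regret_le_regretBound hplay⟩
  · intro Δ hΔ0 hΔ R hR δ hδ
    obtain ⟨T₀, hplays⟩ :=
      hΔ.exists_time_forall_suboptimalPlays_le hΔ0 hd hbounded hforced hR hδ
    refine ⟨T₀, fun Ω _ P _ A η hrun => ?_⟩
    refine hrun.one_sub_le_measureReal hforced hR hδ fun ω hδ1 hnoise t ht => ?_
    have hplay := hplays hδ1 _ _ (hrun.follows ω) hnoise t ht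
    exact ⟨hplay, regret_le_regretBound hplay⟩
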